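/- Let $d\ge 2$, $k\ge 0$ be integers and let $\gamma,\eta,\theta$ be real constants. Let $\Omega\subset\mathbb R^d$ be a bounded polyhedral domain with a finite partition $\mathcal K_h$ into closed polytopes $K$, with set of $(d-1)$-dimensional (flat, polytopal) faces $\mathcal F_h$: the faces of $K$ are the $F\in\mathcal F_h$ with $F\subset\partial K$, they cover $\partial K$, distinct faces overlap in a set of zero surface measure, and each $F$ is either an interior face (shared by exactly two elements) or a boundary face ($F\subset\partial\Omega$, belonging to exactly one element). Each $K$ is star-shaped with respect to a point $\boldsymbol x_K$, and the pyramids $T=T_{K,F}=\bigcup_{y\in F}[\boldsymbol x_K,y]$, $F\subset\partial K$, form a partition of $K$ (no two of them overlap in positive volume); let $\mathcal T_h$ be the set of all these pyramids. Write $h_D=\operatorname{diam} D$ and assume: * every $K$ contains a ball with centre $\boldsymbol x_K$ and radius $\rho_K>0$, $h_K\le\gamma\rho_K$; * every $F$ is star-shaped with respect to one of its points and contains a $(d-1)$-dimensional ball of radius $\rho_F>0$, $h_F\le\gamma\rho_F$; * $h_K\le\eta h_F$ for every face $F$ of $K$; * $\mathcal T_h$ is shape regular: every $T\in\mathcal T_h$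 contains a ball of radius $\rho_T>0$ with $h_T\le\theta\rho_T$. Put $U_h=\prod_{K\in\mathcal K_h}\mathbb P_{k+1}(K)$, and let $\Sigma_h$ be the space of vector fields $\sigma_h$ with $\sigma_h|_T\in\mathbb P_k(T;\mathbb R^d)$ for all $T\in\mathcal T_h$ whose normal component is continuous across every interior face $F\in\mathcal F_h$. Let $\boldsymbol n$ be the unit normal of $F$ that is outward for the first element at $F$, let $[u_h]_F=u_h^1-u_h^2$ (first minus second element) on an interior face and $[u_h]_F=u_h$ on a boundary face, and let $Q_b$ be the $L^2(F)$-projection onto $\mathbb P_k(F)$. Define $$\|u_h\|_{1,h}^2=\sum_{K}\|\nabla u_h\|_K^2+\sum_{F\in\mathcal F_h}h_F^{-1}\|Q_b[u_h]\|_F^2,\qquad \|\sigma_h\|_{0,h}^2=\sum_{K}\|\sigma_h\|_K^2+\sum_{F\in\mathcal F_h}h_F\|\sigma_h\cdot\boldsymbol n\|_F^2,$$ $$b_h(\sigma_h,u_h)=-\sum_{K}(\sigma_h,\nabla u_h)_K+\sum_{F\in\mathcal F_h}\langle\sigma_h\cdot\boldsymbol n,Q_b[u_h]\rangle_F .$$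 Then there is a constant $\beta>0$ depending only on $d,k,\gamma,\eta,\theta$ (in particular independent of the mesh, hence of the mesh size $h$, and of $\Omega$) such that $$\inf_{u_h\in U_h}\ \sup_{\sigma_h\in\Sigma_h}\ \frac{b_h(\sigma_h,u_h)}{\|\sigma_h\|_{0,h}\,\|u_h\|_{1,h}}\ \ge\ \beta ,$$ where the infimum and the supremum run over the $u_h$ and $\sigma_h$ with $\|u_h\|_{1,h}\ne0$ and $\|\sigma_h\|_{0,h}\ne 0$. -/

import Mathlib

open MeasureTheory

noncomputable section

namespace SDG

/-- A closed (possibly nonconvex) polytope: a finite union of convex hulls of finite point sets. -/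
def IsPolytope {d : ℕ} (P : Set (EuclideanSpace ℝ (Fin d))) : Prop :=
  ∃ C : Finset (Finset (EuclideanSpace ℝ (Fin d))),
    P = ⋃ s ∈ C, convexHull ℝ (s : Set (EuclideanSpace ℝ (Fin d)))

/-- Value of a polynomial in the `d` coordinates at a point of `ℝᵈ`. -/
def val {d : ℕ} (p : MvPolynomial (Fin d) ℝ) (x : EuclideanSpace ℝ (Fin d)) : ℝ :=
  MvPolynomial.eval (fun i => x i) p

theorem val_cont {d : ℕ} (p : MvPolynomial (Fin d) ℝ) : Continuous (val p) := by
  unfold val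
  exact (MvPolynomial.continuous_eval p).comp (by fun_prop)

theorem isCompact_of_polytope {d : ℕ} {P : Set (EuclideanSpace ℝ (Fin d))}
    (h : IsPolytope P) : IsCompact P := by
  obtain ⟨C, rfl⟩ := h
  exact C.isCompact_biUnion fun s _ => s.finite_toSet.isCompact_convexHull ℝ

/-- A primal polytopal partition of the open set `Ω ⊆ ℝᵈ`, together with its faces, a center
`x_K` in each element, and a choice of numbering of the two sides of each face.

The faces of an element `K` are the members of the family `face` that lie on its boundary.
The subelement of `K` over its face `F` is the pyramid `conv (x_K, F)`, the union of the segments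
from `x_K` to the points of `F`; these pyramids form the submesh. -/
structure PolytopalMesh (d : ℕ) (Ω : Set (EuclideanSpace ℝ (Fin d))) where
  Cell : Type
  Face : Type
  [cellFintype : Fintype Cell]
  [faceFintype : Fintype Face]
  /-- the closed elements `K` -/
  cell : Cell → Set (EuclideanSpace ℝ (Fin d))
  /-- the closed `(d-1)`-dimensional primal faces `F` -/
  face : Face → Set (EuclideanSpace ℝ (Fin d))
  /-- the center `x_K` of each element -/
  center : Cell → EuclideanSpace ℝ (Fin d)
  /-- the elements on the two sides of a face; they coincide for a boundary face -/
  side₁ : Face → Cell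
  side₂ : Face → Cell
  /-- the unit normal of a face, outward with respect to `side₁` -/
  normal : Face → EuclideanSpace ℝ (Fin d)
  isOpen_domain : IsOpen Ω
  cell_polytope : ∀ K, IsPolytope (cell K)
  cell_regular : ∀ K, closure (interior (cell K)) = cell K
  cell_disjoint : ∀ K K', K ≠ K' → Disjoint (interior (cell K)) (interior (cell K'))
  cell_cover : closure Ω = ⋃ K, cell K
  face_polytope : ∀ F, IsPolytope (face F)
  face_cover : ∀ K, frontier (cell K) = ⋃ F ∈ {F | face F ⊆ frontier (cell K)}, face F
  face_overlap : ∀ F F', F ≠ F' → μHE[d - 1] (face F ∩ face F') = 0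
  face_sides : ∀ F K, face F ⊆ frontier (cell K) ↔ K = side₁ F ∨ K = side₂ F
  face_boundary : ∀ F, face F ⊆ frontier Ω ↔ side₁ F = side₂ F
  normal_unit : ∀ F, ‖normal F‖ = 1
  normal_orth : ∀ F, ∀ y ∈ face F, ∀ z ∈ face F, inner ℝ (normal F) (y - z) = 0
  normal_outward : ∀ F, ∀ y ∈ face F, 0 < inner ℝ (normal F) (y - center (side₁ F))
  /-- each element is star-shaped with respect to its center -/
  cell_star : ∀ K, StarConvex ℝ (center K) (cell K)
  /-- the pyramids of an element do not overlap -/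
  tri_overlap : ∀ K F F', F ≠ F' → face F ⊆ frontier (cell K) → face F' ⊆ frontier (cell K) →
    volume (convexJoin ℝ {center K} (face F) ∩ convexJoin ℝ {center K} (face F')) = 0

attribute [instance] PolytopalMesh.cellFintype PolytopalMesh.faceFintype

namespace PolytopalMesh

variable {d : ℕ} {Ω : Set (EuclideanSpace ℝ (Fin d))} (M : PolytopalMesh d Ω)

/-- The index set of the submesh: pairs of an element and one of its faces. -/
def Tri : Type := {p : M.Cell × M.Face // M.face p.2 ⊆ frontier (M.cell p.1)}

instance : Fintype M.Tri := by
  classical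
  exact inferInstanceAs
    (Fintype {p : M.Cell × M.Face // M.face p.2 ⊆ frontier (M.cell p.1)})

/-- The subelement `T = conv (x_K, F)`. -/
def tri (T : M.Tri) : Set (EuclideanSpace ℝ (Fin d)) :=
  convexJoin ℝ {M.center T.1.1} (M.face T.1.2)

/-- The subelement over `F` in the element `side₁ F`. -/
def tri₁ (F : M.Face) : M.Tri := ⟨(M.side₁ F, F), (M.face_sides F _).2 (Or.inl rfl)⟩

/-- The subelement over `F` in the element `side₂ F`. -/
def tri₂ (F : M.Face) : M.Tri := ⟨(M.side₂ F, F), (M.face_sides F _).2 (Or.inr rfl)⟩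

/-- The regularity assumptions on the mesh, with constants `γ` (chunkiness of the elements and of
the primal faces), `η` (comparability of the diameters of elements and their faces) and `θ` (shape
regularity of the submesh). -/
structure IsRegular (γ η θ : ℝ) : Prop where
  cell_chunky : ∀ K, ∃ ρ : ℝ, 0 < ρ ∧ Metric.closedBall (M.center K) ρ ⊆ M.cell K ∧
    Metric.diam (M.cell K) ≤ γ * ρ
  face_star : ∀ F, ∃ y ∈ M.face F, StarConvex ℝ y (M.face F)
  face_chunky : ∀ F, ∃ y ∈ M.face F, ∃ ρ : ℝ, 0 < ρ ∧
    (∀ z, inner ℝ (M.normal F) (z - y) = 0 → dist z y ≤ ρ → z ∈ M.face F) ∧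
    Metric.diam (M.face F) ≤ γ * ρ
  diam_le : ∀ T : M.Tri, Metric.diam (M.cell T.1.1) ≤ η * Metric.diam (M.face T.1.2)
  tri_regular : ∀ T : M.Tri, ∃ y, ∃ ρ : ℝ, 0 < ρ ∧ Metric.closedBall y ρ ⊆ M.tri T ∧
    Metric.diam (M.tri T) ≤ θ * ρ

/-- `U_h = ∏_K ℙ_{k+1}(K)`. An element has interior points, so a polynomial function on it is
given by a unique polynomial. -/
def U (k : ℕ) : Submodule ℝ (M.Cell → MvPolynomial (Fin d) ℝ) where
  carrier := {u | ∀ K, u K ∈ MvPolynomial.restrictTotalDegree (Fin d) ℝ (k + 1)}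
  add_mem' hu hv K := Submodule.add_mem _ (hu K) (hv K)
  zero_mem' _ := Submodule.zero_mem _
  smul_mem' c _ hu K := Submodule.smul_mem _ c (hu K)

/-- The normal component `σ|_T · n_F` on a face, as a polynomial. -/
def normalComp (F : M.Face) (s : Fin d → MvPolynomial (Fin d) ℝ) : MvPolynomial (Fin d) ℝ :=
  ∑ i, M.normal F i • s i

/-- `Σ_h`: vector fields that are polynomials of degree at most `k` on every subelement and whose
normal component is continuous across the interior primal faces. -/
def Sig (k : ℕ) : Submodule ℝ (M.Tri → Fin d → MvPolynomial (Fin d) ℝ) where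
  carrier := {σ | (∀ T i, σ T i ∈ MvPolynomial.restrictTotalDegree (Fin d) ℝ k) ∧
    ∀ F, ¬ M.face F ⊆ frontier Ω → ∀ x ∈ M.face F,
      val (M.normalComp F (σ (M.tri₁ F))) x = val (M.normalComp F (σ (M.tri₂ F))) x}
  add_mem' := by
    rintro σ τ ⟨h1, h2⟩ ⟨h3, h4⟩
    refine ⟨fun T i => Submodule.add_mem _ (h1 T i) (h3 T i), fun F hF x hx => ?_⟩
    have e1 := h2 F hF x hx
    have e2 := h4 F hF x hx
    simp only [normalComp, val, Pi.add_apply, smul_add, Finset.sum_add_distrib, map_add] at *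
    rw [e1, e2]
  zero_mem' := ⟨fun _ _ => Submodule.zero_mem _, fun _ _ _ _ => rfl⟩
  smul_mem' := by
    rintro c σ ⟨h1, h2⟩
    refine ⟨fun T i => Submodule.smul_mem _ c (h1 T i), fun F hF x hx => ?_⟩
    have e1 := h2 F hF x hx
    simp only [normalComp, val, Pi.smul_apply, smul_comm _ c, ← Finset.smul_sum,
      MvPolynomial.smul_eval] at *
    rw [e1]

/-- The jump `[u]_F`: `u|_{T₁} - u|_{T₂}` on an interior face, `u` on a boundary face. -/
def jump (u : M.Cell → MvPolynomial (Fin d) ℝ) (F : M.Face) : MvPolynomial (Fin d) ℝ :=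
  open Classical in
  if M.face F ⊆ frontier Ω then u (M.side₁ F) else u (M.side₁ F) - u (M.side₂ F)

/-- The defining property of the `L²(F)`-projection `w` of `v` onto `ℙ_k(F)`. -/
def IsProj (k : ℕ) (F : M.Face) (v w : MvPolynomial (Fin d) ℝ) : Prop :=
  w ∈ MvPolynomial.restrictTotalDegree (Fin d) ℝ k ∧
    ∀ q ∈ MvPolynomial.restrictTotalDegree (Fin d) ℝ k,
      ∫ x in M.face F, val w x * val q x ∂μHE[d - 1] =
        ∫ x in M.face F, val v x * val q x ∂μHE[d - 1]

theorem finite_face (F : M.Face) :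
    μHE[d - 1] (M.face F) < ⊤ := by
  rcases (M.face F).eq_empty_or_nonempty with h | ⟨y, hy⟩
  · simp [h]
  have hn : M.normal F ≠ 0 := by
    intro h; have := M.normal_unit F; simp [h] at this
  have hc := isCompact_of_polytope (M.face_polytope F)
  have hfin : Module.finrank ℝ (ℝ ∙ M.normal F)ᗮ = d - 1 := by
    have h1 := Submodule.finrank_add_finrank_orthogonal (ℝ ∙ M.normal F)
    rw [finrank_span_singleton hn, finrank_euclideanSpace_fin] at h1
    omega
  let g : (ℝ ∙ M.normal F)ᗮ → EuclideanSpace ℝ (Fin d) := fun v => (v : EuclideanSpace ℝ (Fin d)) + y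
  have hg : Isometry g := (isometry_add_right y).comp isometry_subtype_coe
  have himg : g '' (g ⁻¹' M.face F) = M.face F := by
    apply Set.image_preimage_eq_of_subset
    intro z hz
    refine ⟨⟨z - y, ?_⟩, by simp [g]⟩
    rw [Submodule.mem_orthogonal_singleton_iff_inner_right]
    exact M.normal_orth F z hz y hy
  rw [← himg, hg.euclideanHausdorffMeasure_image, ← hfin]
  rw [InnerProductSpace.euclideanHausdorffMeasure_eq_volume]
  exact (hg.isClosedEmbedding.isCompact_preimage hc).measure_lt_top

theorem exists_isProj (k : ℕ) (F : M.Face) (v : MvPolynomial (Fin d) ℝ) :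
    ∃ w, M.IsProj k F v w := by
  set ν := (μHE[d - 1]).restrict (M.face F)
  have hc := isCompact_of_polytope (M.face_polytope F)
  have : IsFiniteMeasure ν := ⟨by simpa [ν] using M.finite_face F⟩
  have hm : ∀ p, MemLp (val p) 2 ν := by
    intro p
    obtain ⟨C, hC⟩ := hc.exists_bound_of_continuousOn (val_cont p).continuousOn
    refine MemLp.of_bound (val_cont p).aestronglyMeasurable C ?_
    exact (ae_restrict_iff' hc.measurableSet).2 (Filter.Eventually.of_forall hC)
  let L : MvPolynomial (Fin d) ℝ →ₗ[ℝ] Lp ℝ 2 ν :=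
    { toFun := fun p => (hm p).toLp
      map_add' := fun p q => by
        rw [← MemLp.toLp_add]; congr 1; ext x; simp [val]
      map_smul' := fun c p => by
        rw [RingHom.id_apply, ← MemLp.toLp_const_smul]; congr 1; ext x; simp [val] }
  have hin : ∀ p q, inner ℝ (L p) (L q) = ∫ x, val p x * val q x ∂ν := by
    intro p q
    rw [L2.inner_def]
    refine integral_congr_ae ?_
    filter_upwards [(hm p).coeFn_toLp, (hm q).coeFn_toLp] with x h1 h2
    simp only [L, LinearMap.coe_mk, AddHom.coe_mk, h1, h2]
    simp [mul_comm]
  let W := (MvPolynomial.restrictTotalDegree (Fin d) ℝ k).map L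
  have : FiniteDimensional ℝ W := inferInstance
  obtain ⟨w, hw, hwe⟩ := (W.starProjection_apply_mem (L v))
  refine ⟨w, hw, fun q hq => ?_⟩
  have := W.starProjection_inner_eq_zero (L v) (L q) ⟨q, hq, rfl⟩
  rw [← hwe, inner_sub_left, hin, hin] at this
  linarith
/-- The `L²(F)`-projection `Q_b` onto `ℙ_k(F)` (restrictions to `F` of polynomials of degree at
most `k`), represented by a polynomial on `ℝᵈ`, of which only the values on `F` matter. -/
def Qb (k : ℕ) (F : M.Face) (v : MvPolynomial (Fin d) ℝ) : MvPolynomial (Fin d) ℝ :=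
  (M.exists_isProj k F v).choose

/-- `‖u‖_{1,h}` -/
def normU (k : ℕ) (u : M.Cell → MvPolynomial (Fin d) ℝ) : ℝ :=
  Real.sqrt ((∑ K, ∫ x in M.cell K, ∑ i, (val (MvPolynomial.pderiv i (u K)) x) ^ 2) +
    ∑ F, (Metric.diam (M.face F))⁻¹ *
      ∫ x in M.face F, (val (M.Qb k F (M.jump u F)) x) ^ 2 ∂μHE[d - 1])

/-- `‖σ‖_{0,h}`; the first sum collects `‖σ‖_K²` over the subelements of each element. -/
def normSig (σ : M.Tri → Fin d → MvPolynomial (Fin d) ℝ) : ℝ :=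
  Real.sqrt ((∑ T, ∫ x in M.tri T, ∑ i, (val (σ T i) x) ^ 2) +
    ∑ F, Metric.diam (M.face F) *
      ∫ x in M.face F, (val (M.normalComp F (σ (M.tri₁ F))) x) ^ 2 ∂μHE[d - 1])

/-- `b_h(σ, u) = -∑_K (σ, ∇u)_K + ∑_F ⟨σ·n, Q_b [u]⟩_F`. -/
def b (k : ℕ) (σ : M.Tri → Fin d → MvPolynomial (Fin d) ℝ)
    (u : M.Cell → MvPolynomial (Fin d) ℝ) : ℝ :=
  -(∑ T, ∫ x in M.tri T, ∑ i, val (σ T i) x * val (MvPolynomial.pderiv i (u T.1.1)) x) +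
    ∑ F, ∫ x in M.face F,
      val (M.normalComp F (σ (M.tri₁ F))) x * val (M.Qb k F (M.jump u F)) x ∂μHE[d - 1]

end PolytopalMesh

end SDG

end

noncomputable section

open scoped Pointwise

namespace SDG

/-! The supremum is bounded below by one explicit test field. On the pyramid over `F` in `K` let `σ`
have tangential part minus that of `∇u` and normal component `l F = δ h_F⁻¹ L F`, where `L F` is a
polynomial of degree at most `k` extending `Q_b[u]` off the face. Both sides of a face receive the
same normal component, so `σ` lies in `Σ_h`. With `A = ∑ h_F⁻¹ ‖Q_b[u]‖_F²` and `X` the sum over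
pyramids of the squared norms of the tangential parts of `∇u`, the pairing equals `X + δ A` minus
the cross term `∑_T (l F, ∂_n u)_T`.

Two estimates carry the proof. `exists_integral_le_sum_integral_tangComp` gives `∑_K ‖∇u‖_K² ≤ C₁
X`. For a vector `w`, a ray from the center orthogonal to `w` meets some face; its pyramid is not
flat, so the face normal makes a controlled angle with the ray and cannot be nearly parallel to `w`.
Thus some face sees a fixed fraction of `w` tangentially, and equivalence of polynomial norms moves
this from `K` to the pyramid. `exists_extension` bounds `‖L F‖_T²` by `C₂ h_F ‖Q_b[u]‖_F²`,
extending constantly along the normal.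

Young's inequality splits the cross term into half of the lower bound for `X` and, for small `δ`,
half of `δ A`. Every constant comes from norm equivalence on a reference ball and scaling, hence is
independent of the mesh. -/

/-! ### Polynomials of bounded degree: derivatives, affine substitution, vanishing -/

theorem mem_restrictTotalDegree_pderiv {d k : ℕ} {p : MvPolynomial (Fin d) ℝ}
    (hp : p ∈ MvPolynomial.restrictTotalDegree (Fin d) ℝ (k + 1)) (i : Fin d) :
    MvPolynomial.pderiv i p ∈ MvPolynomial.restrictTotalDegree (Fin d) ℝ k := by
  rw [MvPolynomial.mem_restrictTotalDegree] at hp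
  rw [p.as_sum, map_sum]
  refine Submodule.sum_mem _ fun s hs => ?_
  rw [MvPolynomial.mem_restrictTotalDegree, MvPolynomial.pderiv_monomial]
  by_cases hsi : s i = 0
  · simp [hsi]
  refine (MvPolynomial.totalDegree_monomial_le _ _).trans ?_
  have h1 : s.degree ≤ k + 1 := (MvPolynomial.le_totalDegree hs).trans hp
  have h2 : (s - Finsupp.single i 1) + Finsupp.single i 1 = s := by
    refine tsub_add_cancel_of_le ?_
    rw [Finsupp.single_le_iff]
    omega
  have h3 : (s - Finsupp.single i 1).degree + 1 = s.degree := by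
    conv_rhs => rw [← h2, map_add, Finsupp.degree_single]
  change (s - Finsupp.single i 1).degree ≤ k
  omega

theorem totalDegree_aeval_le {m n : ℕ} (p : MvPolynomial (Fin n) ℝ)
    (f : Fin n → MvPolynomial (Fin m) ℝ) (hf : ∀ i, (f i).totalDegree ≤ 1) :
    (MvPolynomial.aeval f p).totalDegree ≤ p.totalDegree := by
  rw [MvPolynomial.aeval_def, MvPolynomial.eval₂_eq']
  refine MvPolynomial.totalDegree_finsetSum_le fun s hs => ?_
  refine (MvPolynomial.totalDegree_mul _ _).trans ?_
  have h1 : (∏ i, f i ^ s i).totalDegree ≤ ∑ i, s i := by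
    refine (MvPolynomial.totalDegree_finsetProd _ _).trans (Finset.sum_le_sum fun i _ => ?_)
    refine (MvPolynomial.totalDegree_pow _ _).trans ?_
    simpa using Nat.mul_le_mul_left (s i) (hf i)
  have h2 : s.degree ≤ p.totalDegree := MvPolynomial.le_totalDegree hs
  rw [Finsupp.degree_eq_sum] at h2
  have h3 : (algebraMap ℝ (MvPolynomial (Fin m) ℝ) (p.coeff s)).totalDegree = 0 :=
    MvPolynomial.totalDegree_C _
  omega

/-- Used both to rescale balls to the unit ball and, with `m ≠ n`, to pass between a hyperplane and
the whole space. -/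
theorem exists_val_eq_comp_affine {m n k : ℕ} {p : MvPolynomial (Fin n) ℝ}
    (hp : p ∈ MvPolynomial.restrictTotalDegree (Fin n) ℝ k)
    (A : EuclideanSpace ℝ (Fin m) →ₗ[ℝ] EuclideanSpace ℝ (Fin n))
    (c : EuclideanSpace ℝ (Fin n)) :
    ∃ q ∈ MvPolynomial.restrictTotalDegree (Fin m) ℝ k, ∀ x, val q x = val p (A x + c) := by
  let f : Fin n → MvPolynomial (Fin m) ℝ := fun i =>
    ∑ j, MvPolynomial.C (A (EuclideanSpace.single j 1) i) * MvPolynomial.X j + MvPolynomial.C (c i)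
  refine ⟨MvPolynomial.aeval f p, ?_, fun x => ?_⟩
  · rw [MvPolynomial.mem_restrictTotalDegree] at hp ⊢
    refine (totalDegree_aeval_le p f fun i => ?_).trans hp
    refine (MvPolynomial.totalDegree_add _ _).trans (max_le ?_ (by simp))
    refine MvPolynomial.totalDegree_finsetSum_le fun j _ => ?_
    refine (MvPolynomial.totalDegree_mul _ _).trans ?_
    simp
  · have hx : x = ∑ j, x j • EuclideanSpace.single j (1 : ℝ) := by
      ext i
      simp [Finset.sum_apply, Pi.single_apply]
    have hA : ∀ i, A x i = ∑ j, A (EuclideanSpace.single j 1) i * x j := by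
      intro i
      conv_lhs => rw [hx, map_sum]
      simp [mul_comm]
    unfold val
    change MvPolynomial.eval _ (MvPolynomial.bind₁ f p) = _
    rw [← MvPolynomial.coe_aeval_eq_eval, RingHom.coe_coe, MvPolynomial.aeval_bind₁,
      ← MvPolynomial.coe_aeval_eq_eval, RingHom.coe_coe]
    congr 2
    funext i
    simp [f, hA]

theorem eq_zero_of_val_eq_zero {m : ℕ} {p : MvPolynomial (Fin m) ℝ}
    {s : Set (EuclideanSpace ℝ (Fin m))} (hs : IsOpen s) (h0 : 0 ∈ s)
    (h : ∀ x ∈ s, val p x = 0) : p = 0 := by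
  have hnhds : (WithLp.toLp 2 : (Fin m → ℝ) → EuclideanSpace ℝ (Fin m)) ⁻¹' s ∈ nhds 0 := by
    refine (PiLp.continuous_toLp 2 _).continuousAt.preimage_mem_nhds ?_
    exact hs.mem_nhds (by simpa using h0)
  obtain ⟨ε, hε, hsub⟩ := Metric.mem_nhds_iff.1 hnhds
  refine MvPolynomial.funext_set (fun _ => Metric.ball (0 : ℝ) ε) (fun _ => ?_) fun x hx => ?_
  · exact infinite_of_mem_nhds 0 (Metric.ball_mem_nhds _ hε)
  · have hx' : x ∈ Metric.ball (0 : Fin m → ℝ) ε := by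
      rw [ball_pi _ hε]
      simpa using hx
    simpa [val] using h _ (hsub hx')

/-! ### Equivalence of polynomial norms and its scaling -/

theorem integrableOn_of_isCompact {m : ℕ} {f : EuclideanSpace ℝ (Fin m) → ℝ} (hf : Continuous f)
    {s : Set (EuclideanSpace ℝ (Fin m))} (hs : IsCompact s) : IntegrableOn f s :=
  hf.continuousOn.integrableOn_compact hs

/-- The map `g ∘ f⁻¹` on the finite-dimensional range of `f` is continuous; `C` is its operator
norm. No norm on `V` is needed. -/
theorem exists_norm_le_of_injective {V E G : Type*} [AddCommGroup V] [Module ℝ V]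
    [FiniteDimensional ℝ V] [NormedAddCommGroup E] [NormedSpace ℝ E] [NormedAddCommGroup G]
    [NormedSpace ℝ G] (f : V →ₗ[ℝ] E) (g : V →ₗ[ℝ] G) (hf : Function.Injective f) :
    ∃ C : ℝ, ∀ v, ‖g v‖ ≤ C * ‖f v‖ := by
  let e : V ≃ₗ[ℝ] LinearMap.range f := LinearEquiv.ofInjective f hf
  let h := (g ∘ₗ e.symm.toLinearMap).toContinuousLinearMap
  refine ⟨‖h‖, fun v => ?_⟩
  have h1 : ‖h (e v)‖ ≤ ‖h‖ * ‖f v‖ := h.le_opNorm _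
  have h2 : h (e v) = g v := by simp [h]
  exact h2 ▸ h1

theorem exists_linearMap_norm_sq_eq_integral {m : ℕ} {B : Set (EuclideanSpace ℝ (Fin m))}
    (hB : IsCompact B) :
    ∃ f : MvPolynomial (Fin m) ℝ →ₗ[ℝ] Lp ℝ 2 (volume.restrict B),
      ∀ p, ‖f p‖ ^ 2 = ∫ z in B, val p z ^ 2 := by
  have : IsFiniteMeasure (volume.restrict B) := ⟨by simpa using hB.measure_lt_top⟩
  have hm : ∀ p : MvPolynomial (Fin m) ℝ, MemLp (val p) 2 (volume.restrict B) := by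
    intro p
    obtain ⟨C, hC⟩ := hB.exists_bound_of_continuousOn (val_cont p).continuousOn
    refine MemLp.of_bound (val_cont p).aestronglyMeasurable C ?_
    exact (ae_restrict_iff' hB.measurableSet).2 (Filter.Eventually.of_forall hC)
  refine ⟨{ toFun := fun p => (hm p).toLp
            map_add' := fun p q => by
              rw [← MemLp.toLp_add]; congr 1; ext x; simp [val]
            map_smul' := fun c p => by
              rw [RingHom.id_apply, ← MemLp.toLp_const_smul]; congr 1; ext x; simp [val] },
    fun p => ?_⟩
  rw [← real_inner_self_eq_norm_sq, L2.inner_def]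
  refine integral_congr_ae ?_
  filter_upwards [(hm p).coeFn_toLp] with x h1
  simp only [LinearMap.coe_mk, AddHom.coe_mk, h1]
  simp [sq]

theorem eq_zero_of_integral_sq_eq_zero {m : ℕ} {p : MvPolynomial (Fin m) ℝ}
    (h0 : ∫ z in Metric.closedBall (0 : EuclideanSpace ℝ (Fin m)) 1, val p z ^ 2 = 0) :
    p = 0 := by
  rw [setIntegral_eq_zero_iff_of_nonneg_ae (Filter.Eventually.of_forall fun x => sq_nonneg _)
    (integrableOn_of_isCompact ((val_cont _).pow 2) (isCompact_closedBall _ _))] at h0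
  -- Continuity upgrades almost everywhere to everywhere on an open set, hence the passage to the
  -- open ball.
  have hae : (fun z => val p z)
      =ᵐ[volume.restrict (Metric.ball (0 : EuclideanSpace ℝ (Fin m)) 1)] fun _ => 0 := by
    have := ae_mono (Measure.restrict_mono_set volume
      (Metric.ball_subset_closedBall (x := (0 : EuclideanSpace ℝ (Fin m))) (ε := 1))) h0
    filter_upwards [this] with z hz
    simpa using hz
  have := Measure.eqOn_open_of_ae_eq hae Metric.isOpen_ball (val_cont _).continuousOn
    continuousOn_const
  exact eq_zero_of_val_eq_zero Metric.isOpen_ball (by simp) fun x hx => this hx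

def valOn {m : ℕ} (S : Set (EuclideanSpace ℝ (Fin m))) :
    MvPolynomial (Fin m) ℝ →ₗ[ℝ] C(S, ℝ) where
  toFun p := ⟨fun x => val p x, (val_cont p).comp continuous_subtype_val⟩
  map_add' p q := by ext x; simp [val]
  map_smul' c p := by ext x; simp [val]

/-- On polynomials of bounded degree, the maximum over a large ball is controlled by the `L²` norm
over the unit ball. -/
theorem exists_sq_le_integral_unitBall (m k : ℕ) (R : ℝ) :
    ∃ C : ℝ, 0 ≤ C ∧ ∀ p ∈ MvPolynomial.restrictTotalDegree (Fin m) ℝ k,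
      ∀ x ∈ Metric.closedBall (0 : EuclideanSpace ℝ (Fin m)) R,
        val p x ^ 2 ≤ C * ∫ z in Metric.closedBall (0 : EuclideanSpace ℝ (Fin m)) 1,
          val p z ^ 2 := by
  obtain ⟨f, hf⟩ := exists_linearMap_norm_sq_eq_integral
    (isCompact_closedBall (0 : EuclideanSpace ℝ (Fin m)) 1)
  have hinj : Function.Injective f := by
    rw [injective_iff_map_eq_zero]
    intro p hp
    refine eq_zero_of_integral_sq_eq_zero ?_
    rw [← hf, hp, norm_zero, sq, zero_mul]
  obtain ⟨C, hC⟩ := exists_norm_le_of_injective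
    (f ∘ₗ (MvPolynomial.restrictTotalDegree (Fin m) ℝ k).subtype)
    (valOn (Metric.closedBall 0 R) ∘ₗ (MvPolynomial.restrictTotalDegree (Fin m) ℝ k).subtype)
    (hinj.comp Subtype.val_injective)
  refine ⟨C ^ 2, sq_nonneg _, fun p hp x hx => ?_⟩
  have h3 : |val p x| ≤ ‖valOn (Metric.closedBall 0 R) p‖ :=
    (valOn (Metric.closedBall 0 R) p).norm_coe_le_norm ⟨x, hx⟩
  have h4 : ‖valOn (Metric.closedBall 0 R) p‖ ≤ C * ‖f p‖ := hC ⟨p, hp⟩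
  rw [← hf p, ← mul_pow, ← sq_abs]
  exact pow_le_pow_left₀ (abs_nonneg _) (h3.trans h4) 2

/-- The substitution `z ↦ ρ z + y` reduces to the unit ball and preserves the degree; its Jacobian
is the factor `(ρ ^ m)⁻¹`. -/
theorem exists_sq_le_integral_closedBall (m k : ℕ) (R : ℝ) :
    ∃ C : ℝ, 0 ≤ C ∧ ∀ p ∈ MvPolynomial.restrictTotalDegree (Fin m) ℝ k,
      ∀ (y : EuclideanSpace ℝ (Fin m)) (ρ : ℝ), 0 < ρ → ∀ x ∈ Metric.closedBall y (R * ρ),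
        val p x ^ 2 ≤ C * (ρ ^ m)⁻¹ * ∫ z in Metric.closedBall y ρ, val p z ^ 2 := by
  obtain ⟨C, hC, h⟩ := exists_sq_le_integral_unitBall m k R
  refine ⟨C, hC, fun p hp y ρ hρ x hx => ?_⟩
  obtain ⟨q, hq, hqp⟩ := exists_val_eq_comp_affine hp (ρ • LinearMap.id) y
  have hxq : val p x = val q (ρ⁻¹ • (x - y)) := by
    rw [hqp]; simp [smul_smul, hρ.ne']
  have h1 := h q hq (ρ⁻¹ • (x - y)) (by
    rw [mem_closedBall_zero_iff, norm_smul, norm_inv, Real.norm_of_nonneg hρ.le,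
      inv_mul_le_iff₀ hρ, ← dist_eq_norm, mul_comm]
    exact hx)
  have h2 : ∫ z in Metric.closedBall (0 : EuclideanSpace ℝ (Fin m)) 1, val q z ^ 2 =
      (ρ ^ m)⁻¹ * ∫ z in Metric.closedBall y ρ, val p z ^ 2 := by
    have h3 := Measure.setIntegral_comp_smul_of_pos (volume : Measure (EuclideanSpace ℝ (Fin m)))
      (fun z => val p (z + y) ^ 2) (Metric.closedBall 0 1) hρ
    have h4 := (measurePreserving_add_right volume y).setIntegral_preimage_emb
      (measurableEmbedding_addRight y) (fun z => val p z ^ 2) (Metric.closedBall y ρ)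
    simp only [finrank_euclideanSpace_fin, smul_eq_mul] at h3
    have h5 : ρ • Metric.closedBall (0 : EuclideanSpace ℝ (Fin m)) 1 =
        (fun z => z + y) ⁻¹' Metric.closedBall y ρ := by
      rw [smul_closedBall _ _ zero_le_one]
      ext z
      simp [Real.norm_of_nonneg hρ.le]
    rw [← h4, ← h5, ← h3]
    simp [hqp]
  rw [hxq, mul_assoc, ← h2]
  exact h1

/-! ### Elementary geometry: cones, orthogonal directions, rays -/

theorem isCompact_convexJoin_singleton {d : ℕ} (c : EuclideanSpace ℝ (Fin d))
    {F : Set (EuclideanSpace ℝ (Fin d))} (hF : IsCompact F) :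
    IsCompact (convexJoin ℝ {c} F) := by
  have h : convexJoin ℝ {c} F = (fun p : ℝ × EuclideanSpace ℝ (Fin d) => c + p.1 • (p.2 - c)) ''
      (Set.Icc (0 : ℝ) 1 ×ˢ F) := by
    ext x
    simp only [convexJoin_singleton_left, Set.mem_iUnion, segment_eq_image', Set.mem_image,
      Set.mem_prod, Prod.exists, exists_prop]
    constructor
    · rintro ⟨y, hy, t, ht, rfl⟩
      exact ⟨t, y, ⟨ht, hy⟩, rfl⟩
    · rintro ⟨t, y, ⟨ht, hy⟩, rfl⟩
      exact ⟨y, hy, t, ht, rfl⟩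
  rw [h]
  exact (isCompact_Icc.prod hF).image (by fun_prop)

theorem exists_unit_orthogonal {d : ℕ} (hd : 2 ≤ d) (w : EuclideanSpace ℝ (Fin d)) :
    ∃ e : EuclideanSpace ℝ (Fin d), ‖e‖ = 1 ∧ inner ℝ w e = 0 := by
  have h1 := Submodule.finrank_add_finrank_orthogonal (ℝ ∙ w)
  rw [finrank_euclideanSpace_fin] at h1
  have h2 : Module.finrank ℝ (ℝ ∙ w) ≤ 1 := by
    simpa using finrank_span_le_card (R := ℝ) ({w} : Set (EuclideanSpace ℝ (Fin d)))
  have : Nontrivial (ℝ ∙ w)ᗮ := Module.nontrivial_of_finrank_pos (R := ℝ) (by omega)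
  obtain ⟨e, he⟩ := exists_norm_eq (ℝ ∙ w)ᗮ zero_le_one
  exact ⟨e, he, (Submodule.mem_orthogonal_singleton_iff_inner_right).1 e.2⟩

/-- Bessel's inequality for `n` and the orthonormal pair `e`, `w / ‖w‖`, cleared of denominators. It
bounds the tangential part of `w` from below by `‖w‖² ⟨n, e⟩²`. -/
theorem sq_mul_inner_sq_add_inner_sq_le {E : Type*} [NormedAddCommGroup E]
    [InnerProductSpace ℝ E] {n e w : E} (hn : ‖n‖ = 1) (he : ‖e‖ = 1) (hwe : inner ℝ w e = 0) :
    ‖w‖ ^ 2 * inner ℝ n e ^ 2 + inner ℝ n w ^ 2 ≤ ‖w‖ ^ 2 := by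
  rcases eq_or_ne w 0 with rfl | hw
  · simp
  have hw2 : 0 < ‖w‖ ^ 2 := by positivity
  have h1 : inner ℝ (‖w‖ ^ 2 • n - inner ℝ n w • w) e = ‖w‖ ^ 2 * inner ℝ n e := by
    simp [inner_sub_left, inner_smul_left, hwe]
  have h2 : ‖‖w‖ ^ 2 • n - inner ℝ n w • w‖ ^ 2 = ‖w‖ ^ 2 * (‖w‖ ^ 2 - inner ℝ n w ^ 2) := by
    rw [norm_sub_sq_real, norm_smul, norm_smul, inner_smul_left, inner_smul_right, hn]
    simp only [norm_pow, conj_trivial, Real.norm_eq_abs, mul_pow, sq_abs]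
    ring
  have h3 := abs_real_inner_le_norm (‖w‖ ^ 2 • n - inner ℝ n w • w) e
  rw [he, mul_one, h1] at h3
  have h4 := pow_le_pow_left₀ (abs_nonneg _) h3 2
  rw [sq_abs, h2, mul_pow, sq (‖w‖ ^ 2), mul_assoc] at h4
  have h5 := le_of_mul_le_mul_left h4 hw2
  linarith

theorem exists_ray_mem_frontier {d : ℕ} {K : Set (EuclideanSpace ℝ (Fin d))} (hK : IsCompact K)
    {c e : EuclideanSpace ℝ (Fin d)} (hc : c ∈ K) (he : ‖e‖ = 1) :
    ∃ t : ℝ, 0 ≤ t ∧ t ≤ Metric.diam K ∧ c + t • e ∈ frontier K := by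
  have hcont : Continuous fun t : ℝ => c + t • e := by fun_prop
  have hdist : ∀ t : ℝ, dist (c + t • e) c = |t| := fun t => by
    simp [dist_eq_norm, norm_smul, he]
  have hcl : IsClosed ((fun t : ℝ => c + t • e) ⁻¹' K) := hK.isClosed.preimage hcont
  have hS : IsCompact ((fun t : ℝ => c + t • e) ⁻¹' K) := by
    refine (isCompact_Icc (a := -Metric.diam K) (b := Metric.diam K)).of_isClosed_subset hcl
      fun t ht => ?_
    have := Metric.dist_le_diam_of_mem hK.isBounded ht hc
    rw [hdist] at this
    exact abs_le.1 this
  -- The last point of the ray in `K`: were it interior, a slightly larger parameter would still be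
  -- admissible.
  obtain ⟨t, ht, hmax⟩ := hS.exists_isMaxOn ⟨0, by simpa using hc⟩ continuousOn_id
  have h0 : 0 ≤ t := hmax (show (0 : ℝ) ∈ _ by simpa using hc)
  refine ⟨t, h0, ?_, ?_⟩
  · have := Metric.dist_le_diam_of_mem hK.isBounded ht hc
    rw [hdist] at this
    exact (le_abs_self t).trans this
  · refine ⟨subset_closure ht, fun hint => ?_⟩
    have hn : {t : ℝ | c + t • e ∈ interior K} ∈ nhds t :=
      hcont.continuousAt.preimage_mem_nhds (isOpen_interior.mem_nhds hint)
    obtain ⟨ε, hε, hsub⟩ := Metric.mem_nhds_iff.1 hn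
    have h1 : t + ε / 2 ∈ Metric.ball t ε := by
      rw [Metric.mem_ball, Real.dist_eq, add_sub_cancel_left, abs_of_pos (by linarith)]
      linarith
    have h2 : t + ε / 2 ≤ t := hmax (interior_subset (s := K) (hsub h1))
    linarith

/-! ### Comparison of integrals over sets, balls and hyperplane discs -/

theorem integral_sq_le_of_forall_le {d : ℕ} {S : Set (EuclideanSpace ℝ (Fin d))}
    (hS : IsCompact S) {y : EuclideanSpace ℝ (Fin d)} {r : ℝ} (hr : 0 ≤ r)
    (hSy : S ⊆ Metric.closedBall y r) {f : EuclideanSpace ℝ (Fin d) → ℝ} (hf : Continuous f)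
    {A : ℝ} (hA : 0 ≤ A) (h : ∀ x ∈ S, f x ≤ A) :
    ∫ x in S, f x ≤
      r ^ d * volume.real (Metric.closedBall (0 : EuclideanSpace ℝ (Fin d)) 1) * A := by
  have h1 : ∫ x in S, f x ≤ ∫ x in S, A :=
    setIntegral_mono_on (integrableOn_of_isCompact hf hS)
      (integrableOn_of_isCompact continuous_const hS) hS.measurableSet h
  rw [setIntegral_const, smul_eq_mul] at h1
  refine h1.trans (mul_le_mul_of_nonneg_right ?_ hA)
  have h2 := Measure.addHaar_real_closedBall' (volume : Measure (EuclideanSpace ℝ (Fin d))) y hr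
  rw [finrank_euclideanSpace_fin] at h2
  rw [← h2]
  exact measureReal_mono hSy (isCompact_closedBall _ _).measure_lt_top.ne

/-- `L²` norms of polynomials of bounded degree on a set and on a ball of comparable size are
comparable. -/
theorem exists_integral_sq_le_integral_closedBall (d k : ℕ) (R : ℝ) :
    ∃ C : ℝ, 0 ≤ C ∧ ∀ p ∈ MvPolynomial.restrictTotalDegree (Fin d) ℝ k,
      ∀ (S : Set (EuclideanSpace ℝ (Fin d))), IsCompact S →
      ∀ (y : EuclideanSpace ℝ (Fin d)) (ρ : ℝ), 0 < ρ → S ⊆ Metric.closedBall y (R * ρ) →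
        ∫ x in S, val p x ^ 2 ≤ C * ∫ z in Metric.closedBall y ρ, val p z ^ 2 := by
  obtain ⟨C, hC, h⟩ := exists_sq_le_integral_closedBall d k R
  -- The absolute value is there because `R` carries no sign condition.
  refine ⟨|R| ^ d * volume.real (Metric.closedBall (0 : EuclideanSpace ℝ (Fin d)) 1) * C,
    by positivity, fun p hp S hS y ρ hρ hSy => ?_⟩
  have hI : 0 ≤ ∫ z in Metric.closedBall y ρ, val p z ^ 2 := integral_nonneg fun _ => sq_nonneg _
  have h1 := integral_sq_le_of_forall_le hS (r := |R| * ρ) (by positivity)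
    (hSy.trans (Metric.closedBall_subset_closedBall (by gcongr; exact le_abs_self R)))
    ((val_cont p).pow 2) (by positivity) (fun x hx => h p hp y ρ hρ x (hSy hx))
  refine h1.trans (le_of_eq ?_)
  rw [mul_pow]
  field_simp

/-- A polynomial on a hyperplane disc extends to a polynomial on the whole space, constant along
the normal, which near the disc is controlled by the `L²` norm on the disc. -/
theorem exists_normal_extension (d k : ℕ) (hd : 2 ≤ d) (R : ℝ) :
    ∃ C : ℝ, 0 ≤ C ∧ ∀ p ∈ MvPolynomial.restrictTotalDegree (Fin d) ℝ k,
      ∀ (n y : EuclideanSpace ℝ (Fin d)) (ρ : ℝ) (F : Set (EuclideanSpace ℝ (Fin d))),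
      ‖n‖ = 1 → 0 < ρ → IsCompact F → μHE[d - 1] F < ⊤ →
      (∀ z ∈ F, inner ℝ n (z - y) = 0) →
      (∀ z, inner ℝ n (z - y) = 0 → dist z y ≤ ρ → z ∈ F) →
      ∃ q ∈ MvPolynomial.restrictTotalDegree (Fin d) ℝ k, (∀ x ∈ F, val q x = val p x) ∧
        ∀ S : Set (EuclideanSpace ℝ (Fin d)), IsCompact S → S ⊆ Metric.closedBall y (R * ρ) →
          ∫ x in S, val q x ^ 2 ≤ C * ρ * ∫ x in F, val p x ^ 2 ∂μHE[d - 1] := by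
  obtain ⟨C, hC, h⟩ := exists_sq_le_integral_closedBall (d - 1) k R
  refine ⟨|R| ^ d * volume.real (Metric.closedBall (0 : EuclideanSpace ℝ (Fin d)) 1) * C,
    by positivity, fun p hp n y ρ F hn hρ hF hFμ hplane hdisc => ?_⟩
  have : Fact (Module.finrank ℝ (EuclideanSpace ℝ (Fin d)) = d - 1 + 1) :=
    ⟨by rw [finrank_euclideanSpace_fin]; omega⟩
  have hn0 : n ≠ 0 := by rintro rfl; simp at hn
  let e := (OrthonormalBasis.fromOrthogonalSpanSingleton (𝕜 := ℝ) (d - 1) hn0).repr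
  -- `ι` parametrizes the hyperplane isometrically and `π` projects onto it. The polynomial `p` is
  -- read in these coordinates as `g`, and the extension is `q = g ∘ π ∘ (· - y)`.
  let ι : EuclideanSpace ℝ (Fin (d - 1)) →ₗᵢ[ℝ] EuclideanSpace ℝ (Fin d) :=
    (ℝ ∙ n)ᗮ.subtypeₗᵢ.comp e.symm.toLinearIsometry
  let π : EuclideanSpace ℝ (Fin d) →ₗ[ℝ] EuclideanSpace ℝ (Fin (d - 1)) :=
    e.toLinearEquiv.toLinearMap ∘ₗ (ℝ ∙ n)ᗮ.orthogonalProjectionOnto.toLinearMap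
  have hπ : ∀ v, ‖π v‖ ≤ ‖v‖ := fun v => by
    simpa [π] using (ℝ ∙ n)ᗮ.norm_orthogonalProjectionOnto_apply_le v
  have hιπ : ∀ v, inner ℝ n v = 0 → ι (π v) = v := fun v hv => by
    have hv' : v ∈ (ℝ ∙ n)ᗮ := (Submodule.mem_orthogonal_singleton_iff_inner_right).2 hv
    simp only [ι, π, LinearMap.comp_apply]
    change ((e.symm (e _) : (ℝ ∙ n)ᗮ) : EuclideanSpace ℝ (Fin d)) = v
    rw [e.symm_apply_apply]
    exact congrArg Subtype.val
      ((ℝ ∙ n)ᗮ.orthogonalProjectionOnto_mem_subspace_eq_self ⟨v, hv'⟩)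
  have hιn : ∀ z, inner ℝ n (ι z) = 0 := fun z =>
    (Submodule.mem_orthogonal_singleton_iff_inner_right).1 (e.symm z).2
  obtain ⟨g, hg, hgp⟩ := exists_val_eq_comp_affine hp ι.toLinearMap y
  obtain ⟨q, hq, hqg⟩ := exists_val_eq_comp_affine hg π (-π y)
  have hqg' : ∀ x, val q x = val g (π (x - y)) := fun x => by
    rw [hqg, map_sub, sub_eq_add_neg]
  have hj : Isometry fun z => ι z + y := (isometry_add_right y).comp ι.isometry
  -- The isometry carries Lebesgue measure on `ℝ^(d-1)` to the surface measure, and the image of the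
  -- ball is a disc inside `F`.
  have hgF : ∫ z in Metric.closedBall 0 ρ, val g z ^ 2 ≤ ∫ x in F, val p x ^ 2 ∂μHE[d - 1] := by
    have hme : MeasurableEmbedding fun z => ι z + y := hj.isClosedEmbedding.measurableEmbedding
    have himg : (fun z => ι z + y) '' Metric.closedBall 0 ρ ⊆ F := by
      rintro _ ⟨z, hz, rfl⟩
      refine hdisc _ (by simp [hιn]) ?_
      simpa [dist_eq_norm] using hz
    have hint : IntegrableOn (fun x => val p x ^ 2) F μHE[d - 1] := by
      obtain ⟨A, hA⟩ := hF.exists_bound_of_continuousOn ((val_cont p).pow 2).continuousOn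
      have : IsFiniteMeasure (μHE[d - 1].restrict F) := ⟨by simpa using hFμ⟩
      exact Integrable.of_bound ((val_cont p).pow 2).aestronglyMeasurable A
        ((ae_restrict_iff' hF.measurableSet).2 (Filter.Eventually.of_forall hA))
    have h2 := hme.setIntegral_map (μ := volume) (fun x => val p x ^ 2)
      ((fun z => ι z + y) '' Metric.closedBall 0 ρ)
    rw [Set.preimage_image_eq _ hme.injective] at h2
    rw [← EuclideanSpace.euclideanHausdorffMeasure_eq_volume,
      hj.map_euclideanHausdorffMeasure, Measure.restrict_restrict
        (hme.measurableSet_image.2 Metric.isClosed_closedBall.measurableSet),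
      Set.inter_eq_left.2 (Set.image_subset_range _ _)] at h2
    simp only [hgp]
    rw [← EuclideanSpace.euclideanHausdorffMeasure_eq_volume]
    change ∫ z in _, val p (ι z + y) ^ 2 ∂_ ≤ _
    rw [← h2]
    exact setIntegral_mono_set hint (Filter.Eventually.of_forall fun _ => sq_nonneg _)
      himg.eventuallyLE
  refine ⟨q, hq, fun x hx => ?_, fun S hS hSy => ?_⟩
  · rw [hqg', hgp]
    change val p (ι (π (x - y)) + y) = _
    rw [hιπ _ (hplane x hx), sub_add_cancel]
  · have hI : 0 ≤ ∫ z in Metric.closedBall 0 ρ, val g z ^ 2 := integral_nonneg fun _ => sq_nonneg _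
    have h1 := integral_sq_le_of_forall_le hS (r := |R| * ρ) (by positivity)
      (hSy.trans (Metric.closedBall_subset_closedBall (by gcongr; exact le_abs_self R)))
      ((val_cont q).pow 2)
      (A := C * (ρ ^ (d - 1))⁻¹ * ∫ z in Metric.closedBall 0 ρ, val g z ^ 2) (by positivity)
      (fun x hx => by
        change val q x ^ 2 ≤ _
        rw [hqg']
        refine h g hg 0 ρ hρ _ ?_
        rw [mem_closedBall_zero_iff]
        exact (hπ _).trans (by simpa [dist_eq_norm] using hSy hx))
    refine h1.trans ?_
    -- Volume scales as `ρ ^ d`, the disc as `ρ ^ (d - 1)`; the quotient is the factor `ρ` of the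
    -- claim.
    have h3 : ρ ^ d = ρ ^ (d - 1) * ρ := by rw [← pow_succ]; congr 1; omega
    have h4 : (|R| * ρ) ^ d * volume.real (Metric.closedBall (0 : EuclideanSpace ℝ (Fin d)) 1) *
        (C * (ρ ^ (d - 1))⁻¹ * ∫ z in Metric.closedBall 0 ρ, val g z ^ 2) =
        |R| ^ d * volume.real (Metric.closedBall (0 : EuclideanSpace ℝ (Fin d)) 1) * C * ρ *
          ∫ z in Metric.closedBall 0 ρ, val g z ^ 2 := by
      rw [mul_pow, h3]
      field_simp
    rw [h4]
    gcongr

/-! ### Pyramids of a mesh: summation, counting, heights -/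

namespace PolytopalMesh

variable {d : ℕ} {Ω : Set (EuclideanSpace ℝ (Fin d))} (M : PolytopalMesh d Ω)

theorem isCompact_cell (K : M.Cell) : IsCompact (M.cell K) :=
  isCompact_of_polytope (M.cell_polytope K)

theorem isCompact_face (F : M.Face) : IsCompact (M.face F) :=
  isCompact_of_polytope (M.face_polytope F)

theorem isCompact_tri (T : M.Tri) : IsCompact (M.tri T) :=
  isCompact_convexJoin_singleton _ (M.isCompact_face _)

theorem face_subset_cell (T : M.Tri) : M.face T.1.2 ⊆ M.cell T.1.1 :=
  T.2.trans (M.isCompact_cell _).isClosed.frontier_subset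

theorem face_subset_tri (T : M.Tri) : M.face T.1.2 ⊆ M.tri T :=
  subset_convexJoin_right (Set.singleton_nonempty _)

theorem tri_subset_cell (T : M.Tri) : M.tri T ⊆ M.cell T.1.1 := by
  intro x hx
  simp only [tri, convexJoin_singleton_left, Set.mem_iUnion] at hx
  obtain ⟨y, hy, hxy⟩ := hx
  exact (M.cell_star _).segment_subset (M.face_subset_cell T hy) hxy

/-- The pyramids of `K` lie in `K` and overlap in null sets. -/
theorem sum_integral_tri_le (f : M.Cell → EuclideanSpace ℝ (Fin d) → ℝ)
    (hf : ∀ K, Continuous (f K)) (hf0 : ∀ K x, 0 ≤ f K x) :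
    ∑ T : M.Tri, ∫ x in M.tri T, f T.1.1 x ≤ ∑ K, ∫ x in M.cell K, f K x := by
  classical
  rw [← Finset.sum_fiberwise (s := (Finset.univ : Finset M.Tri)) (g := fun T => T.1.1)]
  refine Finset.sum_le_sum fun K _ => ?_
  have h1 : ∀ T ∈ (Finset.univ : Finset M.Tri).filter (fun T => T.1.1 = K),
      ∫ x in M.tri T, f T.1.1 x = ∫ x in M.tri T, f K x := fun T hT => by
    rw [(Finset.mem_filter.1 hT).2]
  rw [Finset.sum_congr rfl h1]
  let s : {T : M.Tri // T.1.1 = K} → Set (EuclideanSpace ℝ (Fin d)) := fun T => M.tri T.1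
  have hsub : (⋃ T, s T) ⊆ M.cell K := Set.iUnion_subset fun T => by
    have := M.tri_subset_cell T.1
    rwa [T.2] at this
  have hint : IntegrableOn (f K) (M.cell K) :=
    integrableOn_of_isCompact (hf K) (M.isCompact_cell K)
  have hdisj : Pairwise (Function.onFun (AEDisjoint volume) s) := by
    rintro ⟨⟨⟨K₁, F₁⟩, hF₁⟩, rfl⟩ ⟨⟨⟨K₂, F₂⟩, hF₂⟩, rfl : K₂ = K₁⟩ hne
    refine M.tri_overlap K₂ F₁ F₂ ?_ hF₁ hF₂
    rintro rfl
    exact hne rfl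
  have h2 := (hasSum_integral_iUnion_ae
    (fun T : {T : M.Tri // T.1.1 = K} => (M.isCompact_tri T.1).measurableSet.nullMeasurableSet)
    hdisj (hint.mono_set hsub)).unique (hasSum_fintype _)
  have h3 : ∑ T ∈ (Finset.univ : Finset M.Tri).filter (fun T => T.1.1 = K), ∫ x in M.tri T, f K x =
      ∑ T : {T : M.Tri // T.1.1 = K}, ∫ x in M.tri T.1, f K x :=
    Finset.sum_subtype _ (by simp) _
  rw [h3]
  refine h2.symm.le.trans ?_
  exact setIntegral_mono_set hint (Filter.Eventually.of_forall (hf0 K)) hsub.eventuallyLE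

/-- Each face carries at most the two pyramids `tri₁` and `tri₂`, which coincide on the boundary. -/
theorem sum_tri_le_two_mul_sum_face (g : M.Face → ℝ) (hg : ∀ F, 0 ≤ g F) :
    ∑ T : M.Tri, g T.1.2 ≤ 2 * ∑ F, g F := by
  classical
  rw [← Finset.sum_fiberwise (s := (Finset.univ : Finset M.Tri)) (g := fun T => T.1.2),
    Finset.mul_sum]
  refine Finset.sum_le_sum fun F _ => ?_
  have h1 : ∀ T ∈ (Finset.univ : Finset M.Tri).filter (fun T => T.1.2 = F), g T.1.2 = g F :=
    fun T hT => by rw [(Finset.mem_filter.1 hT).2]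
  rw [Finset.sum_congr rfl h1, Finset.sum_const, nsmul_eq_mul]
  refine mul_le_mul_of_nonneg_right ?_ (hg F)
  have h2 : (Finset.univ : Finset M.Tri).filter (fun T => T.1.2 = F) ⊆ {M.tri₁ F, M.tri₂ F} := by
    intro T hT
    obtain ⟨⟨K, F'⟩, hT'⟩ := T
    obtain rfl : F' = F := (Finset.mem_filter.1 hT).2
    rcases (M.face_sides F' K).1 hT' with rfl | rfl
    · exact Finset.mem_insert_self (M.tri₁ F') _
    · exact Finset.mem_insert_of_mem (Finset.mem_singleton_self (M.tri₂ F'))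
  exact_mod_cast (Finset.card_le_card h2).trans Finset.card_le_two

/-- The height of a pyramid is at least the radius of any ball it contains. -/
theorem le_abs_height (T : M.Tri) {z y : EuclideanSpace ℝ (Fin d)} {ρ : ℝ} (hρ : 0 < ρ)
    (hz : Metric.closedBall z ρ ⊆ M.tri T) (hy : y ∈ M.face T.1.2) :
    ρ ≤ |inner ℝ (M.normal T.1.2) (y - M.center T.1.1)| := by
  set n := M.normal T.1.2
  set c := M.center T.1.1
  have hn : ‖n‖ = 1 := M.normal_unit _
  -- All points of the face have the same normal coordinate relative to the center, so a point of
  -- the pyramid has a fraction `t` of it. Comparing `z` with `z + ρ • n` then gives the bound.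
  have key : ∀ x ∈ M.tri T, ∃ t ∈ Set.Icc (0 : ℝ) 1,
      inner ℝ n (x - c) = t * inner ℝ n (y - c) := by
    intro x hx
    simp only [tri, convexJoin_singleton_left, Set.mem_iUnion, segment_eq_image'] at hx
    obtain ⟨y', hy', t, ht, rfl⟩ := hx
    refine ⟨t, ht, ?_⟩
    have h := M.normal_orth _ y' hy' y hy
    rw [add_sub_cancel_left, inner_smul_right]
    have h2 : y' - c = (y' - y) + (y - c) := by abel
    change t * inner ℝ n (y' - c) = _
    rw [h2, inner_add_right, h, zero_add]
  obtain ⟨t₁, ht₁, h₁⟩ := key (z + ρ • n) (hz (by simp [hn, norm_smul, abs_of_pos hρ]))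
  obtain ⟨t₂, ht₂, h₂⟩ := key z (hz (Metric.mem_closedBall_self hρ.le))
  have h3 : inner ℝ n (z + ρ • n - c) = inner ℝ n (z - c) + ρ := by
    rw [add_sub_right_comm, inner_add_right, inner_smul_right, real_inner_self_eq_norm_sq, hn]
    ring
  have h4 : ρ = (t₁ - t₂) * inner ℝ n (y - c) := by linarith
  have h5 : |t₁ - t₂| ≤ 1 := abs_le.2 ⟨by linarith [ht₁.1, ht₂.2], by linarith [ht₁.2, ht₂.1]⟩
  calc ρ = |ρ| := (abs_of_pos hρ).symm
    _ = |t₁ - t₂| * |inner ℝ n (y - c)| := by rw [← abs_mul, ← h4]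
    _ ≤ _ := mul_le_of_le_one_left (abs_nonneg _) h5

/-! ### Quantitative consequences of regularity -/

variable {M} {γ η θ : ℝ}

theorem IsRegular.face_disc (hM : M.IsRegular γ η θ) (hd : 2 ≤ d) (F : M.Face) :
    ∃ y ∈ M.face F, ∃ ρ : ℝ, 0 < ρ ∧
      (∀ z, inner ℝ (M.normal F) (z - y) = 0 → dist z y ≤ ρ → z ∈ M.face F) ∧
      Metric.diam (M.face F) ≤ γ * ρ ∧ ρ ≤ Metric.diam (M.face F) := by
  obtain ⟨y, hy, ρ, hρ, hdisc, hdiam⟩ := hM.face_chunky F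
  refine ⟨y, hy, ρ, hρ, hdisc, hdiam, ?_⟩
  obtain ⟨e, he, hne⟩ := exists_unit_orthogonal hd (M.normal F)
  have h1 : dist (y + ρ • e) y = ρ := by simp [norm_smul, he, abs_of_pos hρ]
  have h2 : y + ρ • e ∈ M.face F := hdisc _ (by simp [inner_smul_right, hne]) h1.le
  exact h1.symm.le.trans (Metric.dist_le_diam_of_mem (M.isCompact_face F).isBounded h2 hy)

theorem IsRegular.diam_face_pos (hM : M.IsRegular γ η θ) (hd : 2 ≤ d) (F : M.Face) :
    0 < Metric.diam (M.face F) := by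
  obtain ⟨y, hy, ρ, hρ, -, -, h⟩ := hM.face_disc hd F
  exact hρ.trans_le h

theorem IsRegular.diam_cell_pos (hM : M.IsRegular γ η θ) (hd : 2 ≤ d) (T : M.Tri) :
    0 < Metric.diam (M.cell T.1.1) :=
  (hM.diam_face_pos hd T.1.2).trans_le
    (Metric.diam_mono (M.face_subset_cell T) (M.isCompact_cell _).isBounded)

theorem IsRegular.eta_pos (hM : M.IsRegular γ η θ) (hd : 2 ≤ d) (T : M.Tri) : 0 < η :=
  pos_of_mul_pos_left ((hM.diam_cell_pos hd T).trans_le (hM.diam_le T)) Metric.diam_nonneg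

/-- The chain is `h_K ≤ η h_F ≤ η h_T ≤ η θ ρ`. -/
theorem IsRegular.tri_ball (hM : M.IsRegular γ η θ) (hd : 2 ≤ d) (T : M.Tri) :
    ∃ y, ∃ ρ : ℝ, 0 < ρ ∧ Metric.closedBall y ρ ⊆ M.tri T ∧
      Metric.diam (M.cell T.1.1) ≤ η * θ * ρ := by
  obtain ⟨y, ρ, hρ, hsub, hdiam⟩ := hM.tri_regular T
  refine ⟨y, ρ, hρ, hsub, (hM.diam_le T).trans ?_⟩
  rw [mul_assoc]
  exact mul_le_mul_of_nonneg_left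
    ((Metric.diam_mono (M.face_subset_tri T) (M.isCompact_tri T).isBounded).trans hdiam)
    (hM.eta_pos hd T).le

/-- In every element, each vector has a quantitatively large tangential part with respect to some
face. -/
theorem IsRegular.exists_tangential_ge (hM : M.IsRegular γ η θ) (hd : 2 ≤ d) (K : M.Cell)
    (w : EuclideanSpace ℝ (Fin d)) :
    ∃ T : M.Tri, T.1.1 = K ∧
      ‖w‖ ^ 2 ≤ (η * θ) ^ 2 * (‖w‖ ^ 2 - inner ℝ (M.normal T.1.2) w ^ 2) := by
  obtain ⟨e, he, hwe⟩ := exists_unit_orthogonal hd w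
  obtain ⟨r, hr, hball, -⟩ := hM.cell_chunky K
  obtain ⟨t, ht0, ht, hfr⟩ := exists_ray_mem_frontier (M.isCompact_cell K)
    (hball (Metric.mem_closedBall_self hr.le)) he
  have hfr' := hfr
  rw [M.face_cover K] at hfr'
  simp only [Set.mem_iUnion] at hfr'
  obtain ⟨F, hF, hyF⟩ := hfr'
  let T : M.Tri := ⟨(K, F), hF⟩
  refine ⟨T, rfl, ?_⟩
  obtain ⟨z, ρ, hρ, hsub, hdiam⟩ := hM.tri_ball hd T
  -- The height of the pyramid is `t |⟨n, e⟩|` with `t ≤ h_K ≤ η θ ρ`, and it is at least `ρ`; hence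
  -- `|⟨n, e⟩|` is bounded below.
  have h1 := M.le_abs_height T hρ hsub hyF
  rw [add_sub_cancel_left, inner_smul_right, abs_mul, abs_of_nonneg ht0] at h1
  set n := M.normal T.1.2
  have h2 : ρ ≤ η * θ * ρ * |inner ℝ n e| :=
    h1.trans (mul_le_mul_of_nonneg_right (ht.trans hdiam) (abs_nonneg _))
  have h3 : 1 ≤ η * θ * |inner ℝ n e| := by
    refine le_of_mul_le_mul_left ?_ hρ
    linarith
  have h4 : 1 ≤ (η * θ) ^ 2 * inner ℝ n e ^ 2 := by
    rw [← sq_abs (inner ℝ n e), ← mul_pow]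
    exact one_le_pow₀ h3
  have h5 := sq_mul_inner_sq_add_inner_sq_le (M.normal_unit T.1.2) he hwe
  calc ‖w‖ ^ 2 ≤ ‖w‖ ^ 2 * ((η * θ) ^ 2 * inner ℝ n e ^ 2) :=
        le_mul_of_one_le_right (sq_nonneg _) h4
    _ = (η * θ) ^ 2 * (‖w‖ ^ 2 * inner ℝ n e ^ 2) := by ring
    _ ≤ _ := mul_le_mul_of_nonneg_left (by linarith) (sq_nonneg _)

end PolytopalMesh

/-! ### Normal and tangential parts, and the two main estimates -/

theorem continuous_val_sq {d : ℕ} (p : MvPolynomial (Fin d) ℝ) :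
    Continuous fun x => val p x ^ 2 :=
  (val_cont p).pow 2

namespace PolytopalMesh

variable {d : ℕ} {Ω : Set (EuclideanSpace ℝ (Fin d))} (M : PolytopalMesh d Ω)

/-- The part of a vector field tangential to a face. -/
def tangComp (F : M.Face) (s : Fin d → MvPolynomial (Fin d) ℝ) : Fin d → MvPolynomial (Fin d) ℝ :=
  fun i => s i - M.normal F i • M.normalComp F s

theorem val_normalComp (F : M.Face) (s : Fin d → MvPolynomial (Fin d) ℝ)
    (x : EuclideanSpace ℝ (Fin d)) :
    val (M.normalComp F s) x = ∑ i, M.normal F i * val (s i) x := by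
  simp [normalComp, val]

theorem val_tangComp (F : M.Face) (s : Fin d → MvPolynomial (Fin d) ℝ) (i : Fin d)
    (x : EuclideanSpace ℝ (Fin d)) :
    val (M.tangComp F s i) x = val (s i) x - M.normal F i * val (M.normalComp F s) x := by
  simp [tangComp, val]

theorem sum_normal_sq (F : M.Face) : ∑ i, M.normal F i ^ 2 = 1 := by
  rw [← EuclideanSpace.real_norm_sq_eq, M.normal_unit, one_pow]

theorem sum_normal_mul_tangComp (F : M.Face) (s : Fin d → MvPolynomial (Fin d) ℝ)
    (x : EuclideanSpace ℝ (Fin d)) :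
    ∑ i, M.normal F i * val (M.tangComp F s i) x = 0 := by
  have h : ∀ i, M.normal F i * val (M.tangComp F s i) x =
      M.normal F i * val (s i) x - M.normal F i ^ 2 * val (M.normalComp F s) x := fun i => by
    rw [val_tangComp]; ring
  simp only [h]
  rw [Finset.sum_sub_distrib, ← Finset.sum_mul, sum_normal_sq, val_normalComp, one_mul, sub_self]

theorem sum_tangComp_mul (F : M.Face) (s : Fin d → MvPolynomial (Fin d) ℝ)
    (x : EuclideanSpace ℝ (Fin d)) :
    ∑ i, val (M.tangComp F s i) x * val (s i) x = ∑ i, val (M.tangComp F s i) x ^ 2 := by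
  rw [← sub_eq_zero, ← Finset.sum_sub_distrib]
  have h : ∀ i, val (M.tangComp F s i) x * val (s i) x - val (M.tangComp F s i) x ^ 2 =
      (M.normal F i * val (M.tangComp F s i) x) * val (M.normalComp F s) x := fun i => by
    rw [val_tangComp]; ring
  simp only [h]
  rw [← Finset.sum_mul, sum_normal_mul_tangComp, zero_mul]

theorem sum_tangComp_sq (F : M.Face) (s : Fin d → MvPolynomial (Fin d) ℝ)
    (x : EuclideanSpace ℝ (Fin d)) :
    ∑ i, val (M.tangComp F s i) x ^ 2 =
      ∑ i, val (s i) x ^ 2 - val (M.normalComp F s) x ^ 2 := by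
  rw [← sum_tangComp_mul]
  have h : ∀ i, val (M.tangComp F s i) x * val (s i) x =
      val (s i) x ^ 2 - (M.normal F i * val (s i) x) * val (M.normalComp F s) x := fun i => by
    rw [val_tangComp]; ring
  simp only [h]
  rw [Finset.sum_sub_distrib, ← Finset.sum_mul, ← val_normalComp]
  ring

theorem normalComp_mem {k : ℕ} (F : M.Face) {s : Fin d → MvPolynomial (Fin d) ℝ}
    (hs : ∀ i, s i ∈ MvPolynomial.restrictTotalDegree (Fin d) ℝ k) :
    M.normalComp F s ∈ MvPolynomial.restrictTotalDegree (Fin d) ℝ k :=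
  Submodule.sum_mem _ fun i _ => Submodule.smul_mem _ _ (hs i)

theorem tangComp_mem {k : ℕ} (F : M.Face) {s : Fin d → MvPolynomial (Fin d) ℝ}
    (hs : ∀ i, s i ∈ MvPolynomial.restrictTotalDegree (Fin d) ℝ k) (i : Fin d) :
    M.tangComp F s i ∈ MvPolynomial.restrictTotalDegree (Fin d) ℝ k :=
  Submodule.sub_mem _ (hs i) (Submodule.smul_mem _ _ (M.normalComp_mem F hs))

/-- The tangential parts, each on the pyramid over its face, control a full polynomial field. -/
theorem exists_integral_le_sum_integral_tangComp (d k : ℕ) (hd : 2 ≤ d) (η θ : ℝ) :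
    ∃ C : ℝ, 0 < C ∧ ∀ (Ω : Set (EuclideanSpace ℝ (Fin d))) (M : PolytopalMesh d Ω) (γ : ℝ),
      M.IsRegular γ η θ → ∀ s : M.Cell → Fin d → MvPolynomial (Fin d) ℝ,
      (∀ K i, s K i ∈ MvPolynomial.restrictTotalDegree (Fin d) ℝ k) →
      ∑ K, ∫ x in M.cell K, ∑ i, val (s K i) x ^ 2 ≤
        C * ∑ T : M.Tri, ∫ x in M.tri T, ∑ i, val (M.tangComp T.1.2 (s T.1.1) i) x ^ 2 := by
  classical
  obtain ⟨C, hC, h⟩ := exists_integral_sq_le_integral_closedBall d k (η * θ)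
  -- The summand `1` only makes the constant strictly positive.
  refine ⟨(η * θ) ^ 2 * C + 1, by positivity, fun Ω M γ hM s hs => ?_⟩
  have hcont : ∀ F (s : Fin d → MvPolynomial (Fin d) ℝ),
      Continuous fun x => ∑ i, val (M.tangComp F s i) x ^ 2 := fun F s =>
    continuous_finsetSum _ fun i _ => continuous_val_sq _
  have hX : ∀ T : M.Tri, 0 ≤ ∫ x in M.tri T, ∑ i, val (M.tangComp T.1.2 (s T.1.1) i) x ^ 2 :=
    fun T => integral_nonneg fun x => Finset.sum_nonneg fun i _ => sq_nonneg _
  -- The pyramid contains a ball of radius `ρ` whose dilation by `η θ` contains `K`; the normal is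
  -- constant, so the tangential part is polynomial on all of `K`.
  have hT : ∀ T : M.Tri, ∫ x in M.cell T.1.1, ∑ i, val (M.tangComp T.1.2 (s T.1.1) i) x ^ 2 ≤
      C * ∫ x in M.tri T, ∑ i, val (M.tangComp T.1.2 (s T.1.1) i) x ^ 2 := by
    intro T
    rw [integral_finsetSum _ fun i _ =>
        integrableOn_of_isCompact (continuous_val_sq _) (M.isCompact_cell _),
      integral_finsetSum _ fun i _ =>
        integrableOn_of_isCompact (continuous_val_sq _) (M.isCompact_tri _), Finset.mul_sum]
    refine Finset.sum_le_sum fun i _ => ?_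
    obtain ⟨y, ρ, hρ, hsub, hdiam⟩ := hM.tri_ball hd T
    refine (h _ (M.tangComp_mem _ (hs _) i) (M.cell T.1.1) (M.isCompact_cell _) y ρ hρ
      fun x hx => ?_).trans (mul_le_mul_of_nonneg_left ?_ hC)
    · exact (Metric.dist_le_diam_of_mem (M.isCompact_cell _).isBounded hx
        (M.tri_subset_cell T (hsub (Metric.mem_closedBall_self hρ.le)))).trans hdiam
    · exact setIntegral_mono_set
        (integrableOn_of_isCompact (continuous_val_sq _) (M.isCompact_tri _))
        (Filter.Eventually.of_forall fun _ => sq_nonneg _) hsub.eventuallyLE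
  -- The good face depends on the point `x`, so the sum runs over all faces of `K`.
  have hK : ∀ K, ∫ x in M.cell K, ∑ i, val (s K i) x ^ 2 ≤
      (η * θ) ^ 2 * ∑ T : M.Tri with T.1.1 = K,
        ∫ x in M.cell K, ∑ i, val (M.tangComp T.1.2 (s K) i) x ^ 2 := by
    intro K
    rw [← integral_finsetSum _ fun T _ =>
      integrableOn_of_isCompact (hcont _ _) (M.isCompact_cell _), ← integral_const_mul]
    refine setIntegral_mono_on
      (integrableOn_of_isCompact (continuous_finsetSum _ fun i _ => continuous_val_sq _)
        (M.isCompact_cell _))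
      (integrableOn_of_isCompact (continuous_const.mul (continuous_finsetSum _ fun T _ =>
        hcont _ _)) (M.isCompact_cell _)) (M.isCompact_cell _).measurableSet fun x _ => ?_
    obtain ⟨T, hTK, hw⟩ := hM.exists_tangential_ge hd K (WithLp.toLp 2 fun i => val (s K i) x)
    have h1 : inner ℝ (M.normal T.1.2) (WithLp.toLp 2 fun i => val (s K i) x) =
        val (M.normalComp T.1.2 (s K)) x := by
      rw [val_normalComp, PiLp.inner_apply]
      simp [mul_comm]
    rw [h1, EuclideanSpace.real_norm_sq_eq] at hw
    simp only at hw
    rw [← sum_tangComp_sq] at hw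
    refine hw.trans (mul_le_mul_of_nonneg_left ?_ (sq_nonneg _))
    exact Finset.single_le_sum
      (f := fun T : M.Tri => ∑ i, val (M.tangComp T.1.2 (s K) i) x ^ 2)
      (fun T _ => Finset.sum_nonneg fun i _ => sq_nonneg _)
      (Finset.mem_filter.2 ⟨Finset.mem_univ _, hTK⟩)
  calc ∑ K, ∫ x in M.cell K, ∑ i, val (s K i) x ^ 2
      ≤ ∑ K, (η * θ) ^ 2 * ∑ T : M.Tri with T.1.1 = K,
        ∫ x in M.cell K, ∑ i, val (M.tangComp T.1.2 (s K) i) x ^ 2 :=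
        Finset.sum_le_sum fun K _ => hK K
    _ = (η * θ) ^ 2 * ∑ T : M.Tri,
        ∫ x in M.cell T.1.1, ∑ i, val (M.tangComp T.1.2 (s T.1.1) i) x ^ 2 := by
        rw [← Finset.mul_sum,
          ← Finset.sum_fiberwise (s := (Finset.univ : Finset M.Tri)) (g := fun T => T.1.1)]
        refine congrArg _ (Finset.sum_congr rfl fun K _ => Finset.sum_congr rfl fun T hTK => ?_)
        rw [(Finset.mem_filter.1 hTK).2]
    _ ≤ (η * θ) ^ 2 * ∑ T : M.Tri,
        C * ∫ x in M.tri T, ∑ i, val (M.tangComp T.1.2 (s T.1.1) i) x ^ 2 :=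
        mul_le_mul_of_nonneg_left (Finset.sum_le_sum fun T _ => hT T) (sq_nonneg _)
    _ ≤ _ := by
        rw [← Finset.mul_sum, ← mul_assoc]
        exact mul_le_mul_of_nonneg_right (by linarith) (Finset.sum_nonneg fun T _ => hX T)

/-- Face polynomials extend to the adjacent pyramids with the expected scaling. -/
theorem exists_extension (d k : ℕ) (hd : 2 ≤ d) (γ η : ℝ) :
    ∃ C : ℝ, 0 < C ∧ ∀ (Ω : Set (EuclideanSpace ℝ (Fin d))) (M : PolytopalMesh d Ω) (θ : ℝ),
      M.IsRegular γ η θ → ∀ (F : M.Face),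
      ∀ p ∈ MvPolynomial.restrictTotalDegree (Fin d) ℝ k,
      ∃ q ∈ MvPolynomial.restrictTotalDegree (Fin d) ℝ k, (∀ x ∈ M.face F, val q x = val p x) ∧
        ∀ T : M.Tri, T.1.2 = F → ∫ x in M.tri T, val q x ^ 2 ≤
          C * Metric.diam (M.face F) * ∫ x in M.face F, val p x ^ 2 ∂μHE[d - 1] := by
  obtain ⟨C, hC, h⟩ := exists_normal_extension d k hd (η * γ)
  refine ⟨C + 1, by positivity, fun Ω M θ hM F p hp => ?_⟩
  obtain ⟨y, hy, ρ, hρ, hdisc, hdiam, hρF⟩ := hM.face_disc hd F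
  obtain ⟨q, hq, hqp, hS⟩ := h p hp (M.normal F) y ρ (M.face F) (M.normal_unit F) hρ
    (M.isCompact_face F) (M.finite_face F) (fun z hz => M.normal_orth F z hz y hy) hdisc
  refine ⟨q, hq, hqp, ?_⟩
  rintro T rfl
  refine (hS (M.tri T) (M.isCompact_tri T) fun x hx => ?_).trans ?_
  · refine (Metric.dist_le_diam_of_mem (M.isCompact_cell T.1.1).isBounded (M.tri_subset_cell T hx)
      (M.face_subset_cell T hy)).trans ((hM.diam_le T).trans ?_)
    rw [mul_assoc]
    exact mul_le_mul_of_nonneg_left hdiam (hM.eta_pos hd T).le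
  · refine mul_le_mul_of_nonneg_right ?_ (integral_nonneg fun _ => sq_nonneg _)
    exact mul_le_mul (by linarith) hρF hρ.le (by linarith)

end PolytopalMesh

/-! ### The test field and its estimates -/

namespace PolytopalMesh

section TestField

variable {d : ℕ} {Ω : Set (EuclideanSpace ℝ (Fin d))} (M : PolytopalMesh d Ω)

/-- The field which on the pyramid over `F` has the normal component `l F` and the opposite of the
tangential part of `s`. -/
def testField (s : M.Cell → Fin d → MvPolynomial (Fin d) ℝ) (l : M.Face → MvPolynomial (Fin d) ℝ) :
    M.Tri → Fin d → MvPolynomial (Fin d) ℝ :=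
  fun T i => M.normal T.1.2 i • l T.1.2 - M.tangComp T.1.2 (s T.1.1) i

variable (s : M.Cell → Fin d → MvPolynomial (Fin d) ℝ) (l : M.Face → MvPolynomial (Fin d) ℝ)

theorem val_testField (T : M.Tri) (i : Fin d) (x : EuclideanSpace ℝ (Fin d)) :
    val (M.testField s l T i) x =
      M.normal T.1.2 i * val (l T.1.2) x - val (M.tangComp T.1.2 (s T.1.1) i) x := by
  simp [testField, val]

theorem val_normalComp_testField (T : M.Tri) (x : EuclideanSpace ℝ (Fin d)) :
    val (M.normalComp T.1.2 (M.testField s l T)) x = val (l T.1.2) x := by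
  rw [val_normalComp]
  have h : ∀ i, M.normal T.1.2 i * val (M.testField s l T i) x =
      M.normal T.1.2 i ^ 2 * val (l T.1.2) x -
        M.normal T.1.2 i * val (M.tangComp T.1.2 (s T.1.1) i) x := fun i => by
    rw [val_testField]; ring
  simp only [h]
  rw [Finset.sum_sub_distrib, ← Finset.sum_mul, sum_normal_sq, sum_normal_mul_tangComp]
  ring

theorem sum_testField_sq (T : M.Tri) (x : EuclideanSpace ℝ (Fin d)) :
    ∑ i, val (M.testField s l T i) x ^ 2 =
      val (l T.1.2) x ^ 2 + ∑ i, val (M.tangComp T.1.2 (s T.1.1) i) x ^ 2 := by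
  have h : ∀ i, val (M.testField s l T i) x ^ 2 =
      M.normal T.1.2 i ^ 2 * val (l T.1.2) x ^ 2
        + val (M.tangComp T.1.2 (s T.1.1) i) x ^ 2
        - (M.normal T.1.2 i * val (M.tangComp T.1.2 (s T.1.1) i) x) * (2 * val (l T.1.2) x) :=
    fun i => by rw [val_testField]; ring
  simp only [h]
  rw [Finset.sum_sub_distrib, Finset.sum_add_distrib, ← Finset.sum_mul, ← Finset.sum_mul,
    sum_normal_sq, sum_normal_mul_tangComp]
  ring

theorem sum_testField_mul (T : M.Tri) (x : EuclideanSpace ℝ (Fin d)) :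
    ∑ i, val (M.testField s l T i) x * val (s T.1.1 i) x =
      val (l T.1.2) x * val (M.normalComp T.1.2 (s T.1.1)) x -
        ∑ i, val (M.tangComp T.1.2 (s T.1.1) i) x ^ 2 := by
  have h : ∀ i, val (M.testField s l T i) x * val (s T.1.1 i) x =
      val (l T.1.2) x * (M.normal T.1.2 i * val (s T.1.1 i) x) -
        val (M.tangComp T.1.2 (s T.1.1) i) x * val (s T.1.1 i) x := fun i => by
    rw [val_testField]; ring
  simp only [h]
  rw [Finset.sum_sub_distrib, ← Finset.mul_sum, sum_tangComp_mul, ← val_normalComp]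

variable {s l}

/-- Normal continuity is automatic: `l` is indexed by faces, so both sides have the normal component
`l F`. -/
theorem testField_mem_Sig {k : ℕ}
    (hs : ∀ K i, s K i ∈ MvPolynomial.restrictTotalDegree (Fin d) ℝ k)
    (hl : ∀ F, l F ∈ MvPolynomial.restrictTotalDegree (Fin d) ℝ k) :
    M.testField s l ∈ M.Sig k := by
  refine ⟨fun T i => Submodule.sub_mem _ (Submodule.smul_mem _ _ (hl _))
    (M.tangComp_mem _ (hs _) i), fun F _ x _ => ?_⟩
  exact (M.val_normalComp_testField s l (M.tri₁ F) x).trans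
    (M.val_normalComp_testField s l (M.tri₂ F) x).symm

end TestField

/-- The stability of the pairing: each `u` has a test field realizing its norm. -/
theorem exists_test_field (d k : ℕ) (hd : 2 ≤ d) (γ η θ : ℝ) :
    ∃ c C : ℝ, 0 < c ∧ 0 < C ∧
      ∀ (Ω : Set (EuclideanSpace ℝ (Fin d))) (M : PolytopalMesh d Ω), M.IsRegular γ η θ →
        ∀ u ∈ M.U k, ∃ σ ∈ M.Sig k,
          c * M.normU k u ^ 2 ≤ M.normSig σ ^ 2 ∧ M.normSig σ ^ 2 ≤ C ^ 2 * M.normU k u ^ 2 ∧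
            c * M.normU k u ^ 2 ≤ M.b k σ u := by
  obtain ⟨C₁, hC₁, hstab⟩ := exists_integral_le_sum_integral_tangComp d k hd η θ
  obtain ⟨C₂, hC₂, hext⟩ := exists_extension d k hd γ η
  -- Chosen so that the Young remainder `C₁ / 2 * Y ≤ C₁ C₂ δ² A` is exactly at most `δ / 2 * A`.
  set δ : ℝ := 1 / (2 * C₁ * C₂) with hδ
  have hδ0 : 0 < δ := by positivity
  have hδC : δ * (C₁ * C₂) = 1 / 2 := by rw [hδ]; field_simp
  -- The first two entries of the minimum are what survives in the pairing from `B` and `A`; `δ ^ 2`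
  -- serves the lower bound on the norm of `σ`.
  refine ⟨min (min (1 / (2 * C₁)) (δ / 2)) (δ ^ 2), 1 + 2 * C₂ * δ ^ 2 + δ ^ 2, by positivity,
    by positivity, fun Ω M hM u hu => ?_⟩
  set s : M.Cell → Fin d → MvPolynomial (Fin d) ℝ := fun K i => MvPolynomial.pderiv i (u K)
  have hs : ∀ K i, s K i ∈ MvPolynomial.restrictTotalDegree (Fin d) ℝ k := fun K i =>
    mem_restrictTotalDegree_pderiv (hu K) i
  choose L hLk hLF hLT using fun F => hext Ω M θ hM F (M.Qb k F (M.jump u F))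
    (M.exists_isProj k F (M.jump u F)).choose_spec.1
  set h : M.Face → ℝ := fun F => Metric.diam (M.face F)
  have hh : ∀ F, 0 < h F := hM.diam_face_pos hd
  -- The weight `h_F⁻¹` turns both `h_F ‖l F‖_F²` and the face pairing into multiples of `h_F⁻¹
  -- ‖Q_b[u]‖_F²`.
  set l : M.Face → MvPolynomial (Fin d) ℝ := fun F => (δ * (h F)⁻¹) • L F
  have hl : ∀ F x, val (l F) x = δ * (h F)⁻¹ * val (L F) x := fun F x => by simp [l, val]
  refine ⟨M.testField s l, M.testField_mem_Sig hs fun F => Submodule.smul_mem _ _ (hLk F), ?_⟩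
  set q : M.Face → ℝ := fun F => ∫ x in M.face F, val (M.Qb k F (M.jump u F)) x ^ 2 ∂μHE[d - 1]
  have hq : ∀ F, 0 ≤ q F := fun F => integral_nonneg fun _ => sq_nonneg _
  set A : ℝ := ∑ F, (h F)⁻¹ * q F
  set B : ℝ := ∑ K, ∫ x in M.cell K, ∑ i, val (s K i) x ^ 2
  set X : ℝ := ∑ T : M.Tri, ∫ x in M.tri T, ∑ i, val (M.tangComp T.1.2 (s T.1.1) i) x ^ 2
  set W : ℝ := ∑ T : M.Tri, ∫ x in M.tri T, ∑ i, val (s T.1.1 i) x ^ 2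
  set Y : ℝ := ∑ T : M.Tri, ∫ x in M.tri T, val (l T.1.2) x ^ 2
  have hsum : ∀ t : Fin d → MvPolynomial (Fin d) ℝ, Continuous fun x => ∑ i, val (t i) x ^ 2 :=
    fun t => continuous_finsetSum _ fun i _ => continuous_val_sq _
  have hsum0 : ∀ (t : Fin d → MvPolynomial (Fin d) ℝ) x, 0 ≤ ∑ i, val (t i) x ^ 2 :=
    fun t x => Finset.sum_nonneg fun i _ => sq_nonneg _
  have hA : 0 ≤ A := Finset.sum_nonneg fun F _ => mul_nonneg (inv_nonneg.2 (hh F).le) (hq F)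
  have hB : 0 ≤ B := Finset.sum_nonneg fun K _ => integral_nonneg fun x => hsum0 _ _
  have hY : 0 ≤ Y := Finset.sum_nonneg fun T _ => integral_nonneg fun x => sq_nonneg _
  have hWB : W ≤ B := M.sum_integral_tri_le (fun K x => ∑ i, val (s K i) x ^ 2)
    (fun K => hsum _) (fun K x => hsum0 _ _)
  have hBX : B ≤ C₁ * X := hstab Ω M γ hM s hs
  have hnormal : ∀ F (t : Fin d → MvPolynomial (Fin d) ℝ) x,
      val (M.normalComp F t) x ^ 2 ≤ ∑ i, val (t i) x ^ 2 := fun F t x => by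
    have h1 := M.sum_tangComp_sq F t x
    have h2 := hsum0 (M.tangComp F t) x
    linarith
  have hXW : X ≤ W := Finset.sum_le_sum fun T _ =>
    setIntegral_mono (integrableOn_of_isCompact (hsum _) (M.isCompact_tri T))
      (integrableOn_of_isCompact (hsum _) (M.isCompact_tri T)) fun x => by
        have h1 := M.sum_tangComp_sq T.1.2 (s T.1.1) x
        have h2 := sq_nonneg (val (M.normalComp T.1.2 (s T.1.1)) x)
        change ∑ i, val (M.tangComp T.1.2 (s T.1.1) i) x ^ 2 ≤ ∑ i, val (s T.1.1 i) x ^ 2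
        linarith
  have hYA : Y ≤ 2 * C₂ * δ ^ 2 * A := by
    have h1 : ∀ T : M.Tri, ∫ x in M.tri T, val (l T.1.2) x ^ 2 ≤
        C₂ * δ ^ 2 * ((h T.1.2)⁻¹ * q T.1.2) := fun T => by
      have h2 := hLT T.1.2 T rfl
      have h3 := (hh T.1.2).ne'
      simp only [hl, mul_pow]
      rw [integral_const_mul]
      refine (mul_le_mul_of_nonneg_left h2 (by positivity)).trans (le_of_eq ?_)
      change δ ^ 2 * (h T.1.2)⁻¹ ^ 2 * (C₂ * h T.1.2 * q T.1.2) = _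
      field_simp
    calc Y ≤ ∑ T : M.Tri, C₂ * δ ^ 2 * ((h T.1.2)⁻¹ * q T.1.2) :=
          Finset.sum_le_sum fun T _ => h1 T
      _ ≤ 2 * ∑ F, C₂ * δ ^ 2 * ((h F)⁻¹ * q F) :=
          M.sum_tri_le_two_mul_sum_face (fun F => C₂ * δ ^ 2 * ((h F)⁻¹ * q F)) fun F =>
            mul_nonneg (by positivity) (mul_nonneg (inv_nonneg.2 (hh F).le) (hq F))
      _ = _ := by rw [← Finset.mul_sum]; ring
  have hU : M.normU k u ^ 2 = B + A := Real.sq_sqrt (add_nonneg hB hA)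
  have hmeas : ∀ F, MeasurableSet (M.face F) := fun F => (M.isCompact_face F).measurableSet
  have hface : ∀ F, ∀ x ∈ M.face F, val (M.normalComp F (M.testField s l (M.tri₁ F))) x =
      δ * (h F)⁻¹ * val (M.Qb k F (M.jump u F)) x := fun F x hx => by
    rw [← hLF F x hx, ← hl]
    exact M.val_normalComp_testField s l (M.tri₁ F) x
  have hS : M.normSig (M.testField s l) ^ 2 = Y + X + δ ^ 2 * A := by
    have h1 : ∑ T : M.Tri, ∫ x in M.tri T, ∑ i, val (M.testField s l T i) x ^ 2 = Y + X := by
      rw [← Finset.sum_add_distrib]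
      refine Finset.sum_congr rfl fun T _ => ?_
      rw [← integral_add (integrableOn_of_isCompact (continuous_val_sq _) (M.isCompact_tri T))
        (integrableOn_of_isCompact (hsum _) (M.isCompact_tri T))]
      simp only [sum_testField_sq]
    have h2 : ∑ F, h F * ∫ x in M.face F,
        val (M.normalComp F (M.testField s l (M.tri₁ F))) x ^ 2 ∂μHE[d - 1] = δ ^ 2 * A := by
      rw [Finset.mul_sum]
      refine Finset.sum_congr rfl fun F _ => ?_
      have h3 : ∫ x in M.face F,
          val (M.normalComp F (M.testField s l (M.tri₁ F))) x ^ 2 ∂μHE[d - 1] =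
          (δ * (h F)⁻¹) ^ 2 * q F := by
        rw [← integral_const_mul]
        refine setIntegral_congr_fun (hmeas F) fun x hx => ?_
        simp only [hface F x hx, mul_pow]
      have h4 := (hh F).ne'
      rw [h3]
      field_simp
    rw [← h1, ← h2]
    refine Real.sq_sqrt (add_nonneg (Finset.sum_nonneg fun T _ => integral_nonneg fun x => hsum0 _ _)
      (Finset.sum_nonneg fun F _ => mul_nonneg (hh F).le (integral_nonneg fun x => sq_nonneg _)))
  have hb : X - (1 / (2 * C₁) * W + C₁ / 2 * Y) + δ * A ≤ M.b k (M.testField s l) u := by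
    have h1 : ∑ F, ∫ x in M.face F, val (M.normalComp F (M.testField s l (M.tri₁ F))) x *
        val (M.Qb k F (M.jump u F)) x ∂μHE[d - 1] = δ * A := by
      rw [Finset.mul_sum]
      refine Finset.sum_congr rfl fun F _ => ?_
      rw [← mul_assoc, ← integral_const_mul]
      refine setIntegral_congr_fun (hmeas F) fun x hx => ?_
      simp only [hface F x hx]
      ring
    have h2 : ∑ T : M.Tri, ∫ x in M.tri T, ∑ i, val (M.testField s l T i) x * val (s T.1.1 i) x ≤
        1 / (2 * C₁) * W + C₁ / 2 * Y - X := by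
      rw [Finset.mul_sum, Finset.mul_sum, ← Finset.sum_add_distrib, ← Finset.sum_sub_distrib]
      refine Finset.sum_le_sum fun T _ => ?_
      have i1 : IntegrableOn (fun x => 1 / (2 * C₁) * ∑ i, val (s T.1.1 i) x ^ 2) (M.tri T) :=
        integrableOn_of_isCompact (continuous_const.mul (hsum _)) (M.isCompact_tri T)
      have i2 : IntegrableOn (fun x => C₁ / 2 * val (l T.1.2) x ^ 2) (M.tri T) :=
        integrableOn_of_isCompact (continuous_const.mul (continuous_val_sq _)) (M.isCompact_tri T)
      have i3 : IntegrableOn (fun x => ∑ i, val (M.tangComp T.1.2 (s T.1.1) i) x ^ 2) (M.tri T) :=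
        integrableOn_of_isCompact (hsum _) (M.isCompact_tri T)
      have i4 : IntegrableOn (fun x => ∑ i, val (M.testField s l T i) x * val (s T.1.1 i) x)
          (M.tri T) :=
        integrableOn_of_isCompact (continuous_finsetSum _ fun i _ =>
          (val_cont _).mul (val_cont _)) (M.isCompact_tri T)
      have i5 : IntegrableOn (fun x => 1 / (2 * C₁) * ∑ i, val (s T.1.1 i) x ^ 2 +
          C₁ / 2 * val (l T.1.2) x ^ 2) (M.tri T) := i1.add i2
      rw [← integral_const_mul, ← integral_const_mul, ← integral_add i1 i2,
        ← integral_sub i5 i3]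
      refine setIntegral_mono i4 (i5.sub i3) fun x => ?_
      change ∑ i, val (M.testField s l T i) x * val (s T.1.1 i) x ≤
        1 / (2 * C₁) * ∑ i, val (s T.1.1 i) x ^ 2 + C₁ / 2 * val (l T.1.2) x ^ 2 -
          ∑ i, val (M.tangComp T.1.2 (s T.1.1) i) x ^ 2
      rw [sum_testField_mul]
      -- Young's inequality with weight `C₁`, so that the gradient term costs `B / (2 C₁)`, half of
      -- the lower bound `B / C₁` for `X`.
      have h3 := mul_le_mul_of_nonneg_left (hnormal T.1.2 (s T.1.1) x)
        (show 0 ≤ 1 / (2 * C₁) by positivity)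
      have h4 : 0 ≤ 1 / (2 * C₁) *
          (val (M.normalComp T.1.2 (s T.1.1)) x - C₁ * val (l T.1.2) x) ^ 2 := by positivity
      have h5 : 1 / (2 * C₁) *
          (val (M.normalComp T.1.2 (s T.1.1)) x - C₁ * val (l T.1.2) x) ^ 2 =
          1 / (2 * C₁) * val (M.normalComp T.1.2 (s T.1.1)) x ^ 2 + C₁ / 2 * val (l T.1.2) x ^ 2 -
            val (l T.1.2) x * val (M.normalComp T.1.2 (s T.1.1)) x := by
        field_simp
        ring
      linarith
    unfold b
    rw [h1]
    change _ ≤ -(∑ T : M.Tri, ∫ x in M.tri T,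
      ∑ i, val (M.testField s l T i) x * val (s T.1.1 i) x) + δ * A
    linarith
  have hBX' : 1 / C₁ * B ≤ X := by
    rw [one_div, inv_mul_le_iff₀ hC₁]
    exact hBX
  have e1 : 1 / C₁ * B = 2 * (1 / (2 * C₁) * B) := by field_simp
  have hc₁ : 0 ≤ 1 / (2 * C₁) * B := by positivity
  set c : ℝ := min (min (1 / (2 * C₁)) (δ / 2)) (δ ^ 2)
  have m1 : c * B ≤ 1 / (2 * C₁) * B :=
    mul_le_mul_of_nonneg_right ((min_le_left _ _).trans (min_le_left _ _)) hB
  have m2 : c * A ≤ δ / 2 * A :=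
    mul_le_mul_of_nonneg_right ((min_le_left _ _).trans (min_le_right _ _)) hA
  have m3 : c * A ≤ δ ^ 2 * A := mul_le_mul_of_nonneg_right (min_le_right _ _) hA
  have m4 : 1 / (2 * C₁) * W ≤ 1 / (2 * C₁) * B := mul_le_mul_of_nonneg_left hWB (by positivity)
  have m5 : C₁ / 2 * Y ≤ δ / 2 * A := by
    refine (mul_le_mul_of_nonneg_left hYA (by positivity)).trans (le_of_eq ?_)
    calc C₁ / 2 * (2 * C₂ * δ ^ 2 * A) = δ * (C₁ * C₂) * (δ * A) := by ring
      _ = δ / 2 * A := by rw [hδC]; ring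
  rw [hU, hS]
  refine ⟨by linarith, ?_, by linarith⟩
  set D : ℝ := 1 + 2 * C₂ * δ ^ 2 + δ ^ 2
  have hD : 1 ≤ D := by
    have : 0 ≤ 2 * C₂ * δ ^ 2 + δ ^ 2 := by positivity
    linarith
  have hD1 : Y + X + δ ^ 2 * A ≤ D * (B + A) := by
    have : D * (B + A) = B + A + (2 * C₂ * δ ^ 2 + δ ^ 2) * B + 2 * C₂ * δ ^ 2 * A + δ ^ 2 * A := by
      ring
    have : 0 ≤ (2 * C₂ * δ ^ 2 + δ ^ 2) * B := by positivity
    linarith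
  refine hD1.trans (mul_le_mul_of_nonneg_right ?_ (add_nonneg hB hA))
  -- The bound with `D` suffices for `D ^ 2` since `D ≥ 1`; the square lets the norms be compared
  -- without roots.
  exact le_self_pow₀ hD two_ne_zero

end PolytopalMesh
end SDG
end

/-! ### The inf-sup condition -/

theorem lemma2p5 (d k : ℕ) (hd : 2 ≤ d) (γ η θ : ℝ) :
    ∃ β : ℝ, 0 < β ∧
      ∀ (Ω : Set (EuclideanSpace ℝ (Fin d))) (M : SDG.PolytopalMesh d Ω),
        M.IsRegular γ η θ →
          (β : EReal) ≤
            ⨅ u ∈ {u | u ∈ M.U k ∧ M.normU k u ≠ 0},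
              ⨆ σ ∈ {σ | σ ∈ M.Sig k ∧ M.normSig σ ≠ 0},
                ((M.b k σ u / (M.normSig σ * M.normU k u) : ℝ) : EReal) := by
  obtain ⟨c, C, hc, hC, h⟩ := SDG.PolytopalMesh.exists_test_field d k hd γ η θ
  refine ⟨c / C, by positivity, fun Ω M hM => le_iInf₂ fun u hu => ?_⟩
  obtain ⟨σ, hσ, h1, h2, h3⟩ := h Ω M hM u hu.1
  have hu0 : 0 < M.normU k u := (Real.sqrt_nonneg _).lt_of_ne' hu.2
  -- The lower bound on the norm of `σ` is what makes it admissible in the supremum.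
  have hσ0 : M.normSig σ ≠ 0 := by
    intro h0
    rw [h0] at h1
    have : 0 < c * M.normU k u ^ 2 := by positivity
    linarith
  have hσ1 : 0 < M.normSig σ := (Real.sqrt_nonneg _).lt_of_ne' hσ0
  refine le_iSup₂_of_le σ ⟨hσ, hσ0⟩ (EReal.coe_le_coe_iff.2 ?_)
  have h4 : M.normSig σ ≤ C * M.normU k u := by
    refine abs_le_of_sq_le_sq' (b := C * M.normU k u) ?_ (by positivity) |>.2
    rwa [mul_pow]
  rw [div_le_div_iff₀ hC (mul_pos hσ1 hu0)]
  calc c * (M.normSig σ * M.normU k u) ≤ c * (C * M.normU k u * M.normU k u) := by gcongr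
    _ = c * M.normU k u ^ 2 * C := by ring
    _ ≤ _ := by gcongr
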